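/- Conventions. A map on an open subset of a Euclidean space is called $\mathcal C^1$ if it is continuously differentiable with locally Lipschitz derivative; a map on an arbitrary subset $S$ of a Euclidean space is $\mathcal C^1$ if near each point of $S$ it is the restriction of a $\mathcal C^1$ map on an open set. For a $\mathcal C^1$ function $V$ on $S$, $\nabla V(x)$ denotes the gradient at $x$ of any local $\mathcal C^1$ extension; below it is only paired with tangent vectors, so the choice does not matter. Setting. Let $\mathcal M\subset\mathbb R^{n}$ be a smooth embedded submanifold without boundary that is a closed subset of $\mathbb R^n$ (compact or not), with the induced metric, and let $b_1,\dots,b_r:\mathcal M\to\mathbb R^n$ be $\mathcal C^1$ with $b_i(p)\in T_p\mathcal M$, such that for some $\lambda>0$, $\sum_{i=1}^r\langle b_i(p),v\rangle^2\ge\lambda\langle v,v\rangle$ for all $p\in\mathcal M$, $v\in T_p\mathcal M$. The plant is $\dot p=\sum_{i=1}^r b_i(p)\theta_iu_i$. Gains. Let $\mathcal E\subset\mathbb R^r$ be finite, $T_\circ>0$, $\chi_1>0$, $\chi_2\in(0,1)$. The vector $\theta=(\theta_1,\dots,\theta_{r+2})$ evolves by the hybrid automaton with flow set $\Theta_C=\mathcal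 E\times[0,1]\times[0,T_\circ]$, flow map $F_e(\theta)=\{0\}\times[0,\chi_1]\times([0,\chi_2]-\mathbb I_{\mathcal E_b}(\theta))$, where $\mathcal E_b=\{\theta:\theta_i=0\text{ for some }i\le r\}$, jump set $\Theta_D=\mathcal E\times\{1\}\times[0,T_\circ]$ and jump map $G_e(\theta)=(\mathcal E\setminus\{(\theta_1,\dots,\theta_r)\})\times\{0\}\times\{\theta_{r+2}\}$. Synergistic family. Let $N\ge1$, $\mathcal Q=\{1,\dots,N\}$, $p^\star\in\mathcal M$, $\delta>0$, and let $V_q:\mathcal M\to\mathbb R_{\ge0}$, $q\in\mathcal Q$, be $\mathcal C^1$ functions such that, for every $q$: $V_q(p^\star)=0$ and $V_q>0$ on $\mathcal M\setminus\{p^\star\}$; $\{p\in\mathcal M: V_q(p)\le c\}$ is compact for every $c\ge0$; with $\mathrm{Crit}(V_q)=\{p\in\mathcal M:\nabla V_q(p)\perp T_p\mathcal M\}$, some open neighbourhood $\mathcal U_q\subset\mathbb R^n$ of $p^\star$ satisfies $\mathcal U_q\cap\mathrm{Crit}(V_q)=\{p^\star\}$; and $$\delta< V_q(p)-\min_{\tilde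 q\in\mathcal Q}V_{\tilde q}(p)\qquad\text{for all }p\in\mathrm{Crit}(V_q)\setminus\{p^\star\}.$$ Hybrid system. Let $x=(p,q)$, $V(x)=V_q(p)$, $\mu(x)=V_q(p)-\min_{\tilde q\in\mathcal Q}V_{\tilde q}(p)$, $\mathcal X=\mathcal M\times\mathcal Q\subset\mathbb R^{n+1}$, $\mathcal X_C=\{x\in\mathcal X:\mu(x)\le\delta\}$, $\mathcal X_D=\{x\in\mathcal X:\mu(x)\ge\delta\}$, $G_{\mathcal X}(x)=\{p\}\times\arg\min_{\tilde q\in\mathcal Q}V_{\tilde q}(p)$ and $f_i(x,\theta)=\theta_i(b_i(p),0)$. Let $\mathcal H$ be the hybrid system with state $\xi=(x,\theta)$, flow set $C=\mathcal X_C\times\Theta_C$, flow $\dot x=\sum_if_i(x,\theta)u_i$, $\dot\theta\in F_e(\theta)$, jump set $D=(\mathcal X_C\times\Theta_D)\cup(\mathcal X_D\times\Theta_C)\cup(\mathcal X_D\times\Theta_D)$, and jump map $G(\xi)$ equal to the union of those of the sets $G_{\mathcal X}(x)\times G_e(\theta)$ (if $\xi\in\mathcal X_D\times\Theta_D$), $\{x\}\times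 G_e(\theta)$ (if $\xi\in\mathcal X_C\times\Theta_D$), $G_{\mathcal X}(x)\times\{\theta\}$ (if $\xi\in\mathcal X_D\times\Theta_C$) whose condition holds. For $\gamma>0$ let $\mathcal H_V$ be the hybrid system with the same $C,D,G$, and flow $\dot x=\bar f(\xi):=-\gamma\sum_{i=1}^r\langle\nabla V(x),f_i(x,\theta)\rangle f_i(x,\theta)$, $\dot\theta\in F_e(\theta)$. Let $\mathcal A=\{p^\star\}\times\mathcal Q$. Claim. $V$ is a strong control Lyapunov function with respect to $\mathcal A$ for $\mathcal H$, i.e. $\mathcal H$ is strongly $\nabla V$-stabilizable; and the gain $\gamma>0$ may be arbitrary. That is, for every $\gamma>0$: (a) $V$ is a strong control Lyapunov function candidate: it is a nonnegative $\mathcal C^1$ function on $\mathcal X$, there are $\mathcal K_\infty$-functions $\alpha_1,\alpha_2$ with $\alpha_1(|x|_{\mathcal A})\le V(x)\le\alpha_2(|x|_{\mathcal A})$ on $\mathcal X$, $\langle\nabla V(x),\bar f(\xi)\rangle\le0$ for all $\xi\in C$, and $V(x')-V(x)\le0$ for all $\xi\in D$ and $(x',\theta')\in G(\xi)$; (b)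 the compact set $\tilde{\mathcal A}=\mathcal A\times(\Theta_C\cup\Theta_D)$ is uniformly globally asymptotically stable for $\mathcal H_V$: there is $\beta\in\mathcal{KL}$ such that every solution $\xi$ of $\mathcal H_V$ on a hybrid time domain, maximal or not, satisfies $|\xi(t,j)|_{\tilde{\mathcal A}}\le\beta(|\xi(0,0)|_{\tilde{\mathcal A}},t+j)$ for all $(t,j)\in\mathrm{dom}(\xi)$. -/

import Mathlib

open Set Filter Topology MeasureTheory
open scoped ContDiff

/-! ### Hybrid dynamical systems -/

/-- The data `(C, F, D, G)` of a hybrid dynamical system: flow on `C` with `ẋ ∈ F x`,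
jump on `D` with `x⁺ ∈ G x`. -/
structure HybridSystem (X : Type*) where
  flowSet : Set X
  flowMap : X → Set X
  jumpSet : Set X
  jumpMap : X → Set X

/-- A compact hybrid time domain `⋃ j < J, [t_j, t_{j+1}] × {j}`, `0 = t_0 ≤ t_1 ≤ ... ≤ t_J`. -/
def IsCompactHybridTimeDomain (E : Set (ℝ × ℕ)) : Prop :=
  ∃ (J : ℕ) (t : ℕ → ℝ), 0 < J ∧ t 0 = 0 ∧ (∀ j < J, t j ≤ t (j + 1)) ∧
    E = {z | z.2 < J ∧ z.1 ∈ Icc (t z.2) (t (z.2 + 1))}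

/-- A (nonempty) hybrid time domain: every truncation is a compact hybrid time domain. -/
def IsHybridTimeDomain (E : Set (ℝ × ℕ)) : Prop :=
  E.Nonempty ∧ (∀ z ∈ E, 0 ≤ z.1) ∧
    ∀ z ∈ E, IsCompactHybridTimeDomain (E ∩ {w | w.1 ∈ Icc 0 z.1 ∧ w.2 ≤ z.2})

/-- A hybrid arc: a function on a hybrid time domain, locally absolutely continuous on each
nondegenerate interval `I_j = {t | (t, j) ∈ dom}`. (The values of `val` off `dom` are irrelevant.) -/
structure HybridArc (X : Type*) [NormedAddCommGroup X] where
  dom : Set (ℝ × ℕ)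
  val : ℝ → ℕ → X
  isHybridTimeDomain : IsHybridTimeDomain dom
  locallyAbsolutelyContinuous : ∀ j : ℕ, (interior {t | (t, j) ∈ dom}).Nonempty →
    ∀ a b : ℝ, (a, j) ∈ dom → (b, j) ∈ dom →
      AbsolutelyContinuousOnInterval (fun t => val t j) a b

/-- The hybrid arc `x` is a solution of the hybrid system `H`. -/
structure HybridSystem.IsSolution {X : Type*} [NormedAddCommGroup X] [NormedSpace ℝ X]
    (H : HybridSystem X) (x : HybridArc X) : Prop where
  initial : x.val 0 0 ∈ H.flowSet ∪ H.jumpSet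
  flow_mem : ∀ j : ℕ, (interior {t | (t, j) ∈ x.dom}).Nonempty →
    ∀ t, (t, j) ∈ x.dom → x.val t j ∈ H.flowSet
  flow_deriv : ∀ j : ℕ, (interior {t | (t, j) ∈ x.dom}).Nonempty →
    ∀ᵐ t : ℝ, (t, j) ∈ x.dom →
      ∃ v ∈ H.flowMap (x.val t j), HasDerivAt (fun s => x.val s j) v t
  jump : ∀ (t : ℝ) (j : ℕ), (t, j) ∈ x.dom → (t, j + 1) ∈ x.dom →
    x.val t j ∈ H.jumpSet ∧ x.val t (j + 1) ∈ H.jumpMap (x.val t j)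

/-! ### Comparison functions and stability -/

/-- Class `𝒦ℒ`: `β : ℝ≥0 × ℝ≥0 → ℝ≥0` nondecreasing in the first and nonincreasing in the second
argument, with `β(r, s) → 0` as `r → 0⁺` and as `s → ∞`. -/
structure IsClassKL (β : ℝ → ℝ → ℝ) : Prop where
  nonneg : ∀ r s, 0 ≤ r → 0 ≤ s → 0 ≤ β r s
  mono : ∀ s, 0 ≤ s → MonotoneOn (fun r => β r s) (Ici 0)
  anti : ∀ r, 0 ≤ r → AntitoneOn (β r) (Ici 0)
  tendsto_zero : ∀ s, 0 ≤ s → Tendsto (fun r => β r s) (𝓝[>] 0) (𝓝 0)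
  tendsto_atTop : ∀ r, 0 ≤ r → Tendsto (β r) atTop (𝓝 0)

/-- Class `𝒦∞`: continuous, strictly increasing, unbounded functions on `[0, ∞)` vanishing
at zero. -/
structure IsClassKInfty (α : ℝ → ℝ) : Prop where
  continuousOn : ContinuousOn α (Ici 0)
  strictMonoOn : StrictMonoOn α (Ici 0)
  zero : α 0 = 0
  tendsto_atTop : Tendsto α atTop atTop

/-- The compact set `A` is uniformly globally asymptotically stable for `H`. -/
def HybridSystem.IsUGAS {X : Type*} [NormedAddCommGroup X] [NormedSpace ℝ X]
    (H : HybridSystem X) (A : Set X) : Prop :=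
  IsCompact A ∧ ∃ β : ℝ → ℝ → ℝ, IsClassKL β ∧
    ∀ x : HybridArc X, H.IsSolution x → ∀ (t : ℝ) (j : ℕ), (t, j) ∈ x.dom →
      Metric.infDist (x.val t j) A ≤ β (Metric.infDist (x.val 0 0) A) (t + j)

/-! ### Functions of class `C¹` on subsets, and their gradients -/

/-- `W` is of class `C¹` on the open set `U` in the sense used here: continuously differentiable
with a locally Lipschitz derivative. -/
def IsC1Lip {X Y : Type*} [NormedAddCommGroup X] [NormedSpace ℝ X] [NormedAddCommGroup Y]
    [NormedSpace ℝ Y] (W : X → Y) (U : Set X) : Prop :=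
  ContDiffOn ℝ 1 W U ∧ LocallyLipschitzOn U (fderiv ℝ W)

/-- `V` is of class `C¹` on the (arbitrary) subset `S`: near each point of `S` it agrees on `S` with
a function of class `C¹` on an open set of the ambient space. For `S` open this is class `C¹`
on `S`; for an embedded submanifold it is class `C¹` on the manifold. -/
def IsC1LipOn {X Y : Type*} [NormedAddCommGroup X] [NormedSpace ℝ X] [NormedAddCommGroup Y]
    [NormedSpace ℝ Y] (V : X → Y) (S : Set X) : Prop :=
  ∀ x ∈ S, ∃ (U : Set X) (W : X → Y), IsOpen U ∧ x ∈ U ∧ IsC1Lip W U ∧ EqOn W V (U ∩ S)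

/-- The ambient gradients `∇V(x)` at `x` of a function `V` of class `C¹` on `S`: the gradients of the
local `C¹` extensions of `V` from `S`. For `S` open there is exactly one. In general they
differ from each other by vectors orthogonal to the tangent space of `S` at `x`, so that the
pairing of `∇V(x)` with a tangent vector does not depend on the choice. -/
def ambientGradients {X : Type*} [NormedAddCommGroup X] [InnerProductSpace ℝ X] [CompleteSpace X]
    (V : X → ℝ) (S : Set X) (x : X) : Set X :=
  {g | ∃ (U : Set X) (W : X → ℝ), IsOpen U ∧ x ∈ U ∧ IsC1Lip W U ∧ EqOn W V (U ∩ S) ∧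
    g = gradient W x}

/-! ### Control-affine hybrid systems and strong control Lyapunov functions -/

/-- An open-loop control-affine hybrid system `ẋ = f₀(x,θ) + ∑ i, f_i(x,θ) u_i` on `flowSet`,
`x⁺ ∈ jumpMap x` on `jumpSet`, whose parameter `θ` is generated by an exogenous hybrid system. -/
structure ControlAffineHybridSystem (X P : Type*) (r : ℕ) where
  flowSet : Set X
  jumpSet : Set X
  jumpMap : X → Set X
  f₀ : X → P → X
  f : Fin r → X → P → X
  exo : HybridSystem P

namespace ControlAffineHybridSystem

variable {X P : Type*} {r : ℕ}

/-- The flow set `C = X_C × Θ_C` of the interconnection, with state `ξ = (x, θ)`. -/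
def C (H : ControlAffineHybridSystem X P r) : Set (WithLp 2 (X × P)) :=
  {ξ | ξ.fst ∈ H.flowSet ∧ ξ.snd ∈ H.exo.flowSet}

/-- The jump set `D = (X_C × Θ_D) ∪ (X_D × Θ_C) ∪ (X_D × Θ_D)` of the interconnection. -/
def D (H : ControlAffineHybridSystem X P r) : Set (WithLp 2 (X × P)) :=
  {ξ | (ξ.fst ∈ H.flowSet ∧ ξ.snd ∈ H.exo.jumpSet) ∨
    (ξ.fst ∈ H.jumpSet ∧ ξ.snd ∈ H.exo.flowSet) ∨
    (ξ.fst ∈ H.jumpSet ∧ ξ.snd ∈ H.exo.jumpSet)}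

/-- The jump map of the interconnection. Where several of the three cases apply, a jump
according to any of them is allowed; this is the outer semicontinuous reading, and it has all the
solutions of any reading in which one of the applicable cases takes precedence. -/
def G (H : ControlAffineHybridSystem X P r) (ξ : WithLp 2 (X × P)) : Set (WithLp 2 (X × P)) :=
  {ξ' | (ξ.fst ∈ H.jumpSet ∧ ξ.snd ∈ H.exo.jumpSet ∧
        ξ'.fst ∈ H.jumpMap ξ.fst ∧ ξ'.snd ∈ H.exo.jumpMap ξ.snd) ∨
    (ξ.fst ∈ H.flowSet ∧ ξ.snd ∈ H.exo.jumpSet ∧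
        ξ'.fst = ξ.fst ∧ ξ'.snd ∈ H.exo.jumpMap ξ.snd) ∨
    (ξ.fst ∈ H.jumpSet ∧ ξ.snd ∈ H.exo.flowSet ∧
        ξ'.fst ∈ H.jumpMap ξ.fst ∧ ξ'.snd = ξ.snd)}

/-- The set `𝒳 = X_C ∪ X_D`. -/
def stateSet (H : ControlAffineHybridSystem X P r) : Set X := H.flowSet ∪ H.jumpSet

variable [NormedAddCommGroup X] [InnerProductSpace ℝ X]

/-- The averaged vector field `f̄ = f₀ - γ ∑ i, ⟨∇V, f_i⟩ f_i` for the value `g` of `∇V(x)`. -/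
noncomputable def averagedField (H : ControlAffineHybridSystem X P r) (γ : ℝ) (g x : X) (θ : P) :
    X :=
  H.f₀ x θ - γ • ∑ i, inner ℝ g (H.f i x θ) • H.f i x θ

/-- The averaged system `H_V`: flow map `{f̄(ξ)} × F_e(θ)`, the other data as for `H`. -/
def averaged [CompleteSpace X] (H : ControlAffineHybridSystem X P r) (V : X → ℝ) (γ : ℝ) :
    HybridSystem (WithLp 2 (X × P)) where
  flowSet := H.C
  flowMap := fun ξ => {v | (∃ g ∈ ambientGradients V H.stateSet ξ.fst,
    v.fst = H.averagedField γ g ξ.fst ξ.snd) ∧ v.snd ∈ H.exo.flowMap ξ.snd}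
  jumpSet := H.D
  jumpMap := H.G

/-- `V` is a strong control Lyapunov function candidate with respect to `A` for `H`, with gain `γ`.
The function `V` matters only on `𝒳 = X_C ∪ X_D`. -/
structure IsSCLFCandidate [CompleteSpace X] (H : ControlAffineHybridSystem X P r) (A : Set X)
    (V : X → ℝ) (γ : ℝ) : Prop where
  gain_pos : 0 < γ
  isCompact : IsCompact A
  subset : A ⊆ H.stateSet
  isC1 : IsC1LipOn V H.stateSet
  nonneg : ∀ x ∈ H.stateSet, 0 ≤ V x
  bounds : ∃ α₁ α₂ : ℝ → ℝ, IsClassKInfty α₁ ∧ IsClassKInfty α₂ ∧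
    ∀ x ∈ H.stateSet, α₁ (Metric.infDist x A) ≤ V x ∧ V x ≤ α₂ (Metric.infDist x A)
  flow_nonpos : ∀ ξ ∈ H.C, ∀ g ∈ ambientGradients V H.stateSet ξ.fst,
    inner ℝ g (H.averagedField γ g ξ.fst ξ.snd) ≤ 0
  jump_nonpos : ∀ ξ ∈ H.D, ∀ ξ' ∈ H.G ξ, V ξ'.fst - V ξ.fst ≤ 0

/-- `V` is a candidate with gain `γ`, and `A × (Θ_C ∪ Θ_D)` is UGAS for the averaged
system `H_V` with the gain `γ`. -/
def IsSCLFWithGain [CompleteSpace X] [NormedAddCommGroup P] [NormedSpace ℝ P]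
    (H : ControlAffineHybridSystem X P r) (A : Set X) (V : X → ℝ) (γ : ℝ) : Prop :=
  H.IsSCLFCandidate A V γ ∧
    (H.averaged V γ).IsUGAS
      {ξ : WithLp 2 (X × P) | ξ.fst ∈ A ∧ ξ.snd ∈ H.exo.flowSet ∪ H.exo.jumpSet}

/-- `H` is strongly `∇V`-stabilizable, that is, `V` is a strong control Lyapunov function with
respect to `A` for `H`. -/
def IsStronglyGradStabilizable [CompleteSpace X] [NormedAddCommGroup P] [NormedSpace ℝ P]
    (H : ControlAffineHybridSystem X P r) (A : Set X) (V : X → ℝ) : Prop :=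
  ∃ γ : ℝ, H.IsSCLFWithGain A V γ

end ControlAffineHybridSystem

/-! ### Submanifolds of Euclidean space -/

/-- `M` is a smooth embedded submanifold (without boundary) of dimension `d`: near each of its points
it is, in a smooth chart of the ambient space, a `d`-dimensional linear subspace. -/
def IsSmoothSubmanifold {E : Type*} [NormedAddCommGroup E] [NormedSpace ℝ E] (d : ℕ)
    (M : Set E) : Prop :=
  ∀ p ∈ M, ∃ (Φ : OpenPartialHomeomorph E E) (S : Submodule ℝ E),
    Module.finrank ℝ S = d ∧ p ∈ Φ.source ∧
    ContDiffOn ℝ ∞ Φ Φ.source ∧ ContDiffOn ℝ ∞ Φ.symm Φ.target ∧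
    Φ '' (Φ.source ∩ M) = Φ.target ∩ (S : Set E)

/-- The tangent space `T_p M`: velocities at `p` of curves in `M`. -/
def tangentVectors {E : Type*} [NormedAddCommGroup E] [NormedSpace ℝ E] (M : Set E) (p : E) :
    Set E :=
  {v | ∃ c : ℝ → E, (∀ᶠ t in 𝓝 (0 : ℝ), c t ∈ M) ∧ c 0 = p ∧ HasDerivAt c v 0}

/-- `Crit V`: the points `p` of `M` at which `∇V(p)` is orthogonal to `T_p M`. -/
def critSet {E : Type*} [NormedAddCommGroup E] [InnerProductSpace ℝ E] [CompleteSpace E]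
    (M : Set E) (V : E → ℝ) : Set E :=
  {p | p ∈ M ∧ ∃ g ∈ ambientGradients V M p, ∀ v ∈ tangentVectors M p, inner ℝ g v = 0}

/-! ### Synergistic families and the switched plant -/

/-- `min_{q ∈ {1, ..., N}} V_q(p)` (for `N ≥ 1`). -/
noncomputable def minPotential {E : Type*} (N : ℕ) (V : ℕ → E → ℝ) (p : E) : ℝ :=
  sInf ((fun q => V q p) '' Icc 1 N)

/-- `{V_q}`, `q ∈ {1, ..., N}`, is a `δ`-gap synergistic family of potential functions on `M` with
respect to `p₀`. The last field says that `δ` is smaller than each value of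
`V_q(p) - min_q' V_q'(p)` at a critical point `p ≠ p₀` of `V_q`. -/
structure IsSynergisticFamily {E : Type*} [NormedAddCommGroup E] [InnerProductSpace ℝ E]
    [CompleteSpace E] (M : Set E) (p₀ : E) (N : ℕ) (V : ℕ → E → ℝ) (δ : ℝ) : Prop where
  one_le : 1 ≤ N
  mem : p₀ ∈ M
  isC1 : ∀ q ∈ Icc 1 N, IsC1LipOn (V q) M
  zero : ∀ q ∈ Icc 1 N, V q p₀ = 0
  pos : ∀ q ∈ Icc 1 N, ∀ p ∈ M, p ≠ p₀ → 0 < V q p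
  compact_sublevel : ∀ q ∈ Icc 1 N, ∀ c : ℝ, 0 ≤ c → IsCompact {p | p ∈ M ∧ V q p ≤ c}
  isolated : ∀ q ∈ Icc 1 N, ∃ U : Set E, IsOpen U ∧ p₀ ∈ U ∧ U ∩ critSet M (V q) = {p₀}
  gap_pos : 0 < δ
  gap : ∀ q ∈ Icc 1 N, ∀ p ∈ critSet M (V q), p ≠ p₀ → δ < V q p - minPotential N V p

/-- The space of the plant and logic states `x = (p, q) ∈ ℝⁿ × ℝ`, with the Euclidean norm. -/
abbrev PlantState (n : ℕ) : Type := WithLp 2 (EuclideanSpace ℝ (Fin n) × ℝ)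

/-- The space of the parameters `θ = ((θ_1, ..., θ_r), (θ_{r+1}, θ_{r+2})) ∈ ℝʳ × ℝ²`, with the
Euclidean norm. -/
abbrev GainState (r : ℕ) : Type := WithLp 2 (EuclideanSpace ℝ (Fin r) × WithLp 2 (ℝ × ℝ))

/-- The function `V(p, q) = V_q(p)`. It is used for `q ∈ {1, ..., N}` only. -/
noncomputable def synergisticPotential {n : ℕ} (V : ℕ → EuclideanSpace ℝ (Fin n) → ℝ)
    (x : PlantState n) : ℝ :=
  V ⌊x.snd⌋₊ x.fst

/-- The set `M × {1, ..., N}`. -/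
def modeProduct {n : ℕ} (M : Set (EuclideanSpace ℝ (Fin n))) (N : ℕ) : Set (PlantState n) :=
  {x | x.fst ∈ M ∧ ∃ q ∈ Icc 1 N, x.snd = (q : ℝ)}

/-- The set `ℰ_b` of parameters with a vanishing gain. -/
def blindSet (r : ℕ) : Set (GainState r) := {θ | ∃ i : Fin r, θ.fst i = 0}

/-- The dwell-time and time-ratio monitor automaton that generates the gains. -/
noncomputable def gainAutomaton {r : ℕ} (𝓔 : Set (EuclideanSpace ℝ (Fin r))) (T₀ χ₁ χ₂ : ℝ) :
    HybridSystem (GainState r) where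
  flowSet := {θ | θ.fst ∈ 𝓔 ∧ θ.snd.fst ∈ Icc 0 1 ∧ θ.snd.snd ∈ Icc 0 T₀}
  flowMap := fun θ => {w | w.fst = 0 ∧ w.snd.fst ∈ Icc 0 χ₁ ∧
    ∃ s ∈ Icc 0 χ₂, w.snd.snd = s - (blindSet r).indicator 1 θ}
  jumpSet := {θ | θ.fst ∈ 𝓔 ∧ θ.snd.fst = 1 ∧ θ.snd.snd ∈ Icc 0 T₀}
  jumpMap := fun θ => {θ' | θ'.fst ∈ 𝓔 \ {θ.fst} ∧ θ'.snd.fst = 0 ∧ θ'.snd.snd = θ.snd.snd}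

/-- The plant `ṗ = ∑ i, b_i(p) θ_i u_i`, `q̇ = 0` with the hysteresis-based switching of the logic
state `q` and the gains generated by the automaton. -/
noncomputable def synergisticPlant {n r : ℕ} (M : Set (EuclideanSpace ℝ (Fin n)))
    (b : Fin r → EuclideanSpace ℝ (Fin n) → EuclideanSpace ℝ (Fin n))
    (N : ℕ) (V : ℕ → EuclideanSpace ℝ (Fin n) → ℝ) (δ : ℝ)
    (𝓔 : Set (EuclideanSpace ℝ (Fin r))) (T₀ χ₁ χ₂ : ℝ) :
    ControlAffineHybridSystem (PlantState n) (GainState r) r where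
  flowSet := {x | x ∈ modeProduct M N ∧
    synergisticPotential V x - minPotential N V x.fst ≤ δ}
  jumpSet := {x | x ∈ modeProduct M N ∧
    δ ≤ synergisticPotential V x - minPotential N V x.fst}
  jumpMap := fun x => {x' | x'.fst = x.fst ∧ ∃ q ∈ Icc 1 N, x'.snd = (q : ℝ) ∧
    IsMinOn (fun q' => V q' x.fst) (Icc 1 N) q}
  f₀ := fun _ _ => 0
  f := fun i x θ => θ.fst i • WithLp.toLp 2 (b i x.fst, 0)
  exo := gainAutomaton 𝓔 T₀ χ₁ χ₂

/-!
The potential `V(p, q) = V_q(p)` does not increase along solutions of the averaged system: it flows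
at the rate `-γ ∑ i, θ_i² ⟨∇V_q, b_i⟩²` and drops by at least `δ` when the mode `q` switches. Since
solutions are confined to the tangent directions of `M`, the choice of the local extension that
defines `∇V_q` is irrelevant.

The flow set contains no critical point of `V_q` other than `p₀`, by the synergy gap, and the `b_i`
span the tangent spaces (`mem_critSet_of_inner_eq_zero`). By compactness, on the part of the flow set
where `a ≤ V ≤ c`, with `a > 0`, the potential decays at least at some rate `w > 0` whenever no gain
`θ_i` vanishes (`exists_uniform_decay`). The monitor `θ_{r+2}` grows at rate at most `χ₂ < 1`, and at
most `χ₂ - 1` while a gain vanishes, so that `V / w + θ_{r+2}` falls at least at rate `1 - χ₂`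
throughout. A jump lowers either `V` by `δ` or the timer `θ_{r+1}` by `1`. Hence a function
`K V + κ θ_{r+2} + θ_{r+1}` with suitable weights falls at least at unit rate in the hybrid time
`t + j`, as long as `V ≥ a`; as it is nonnegative and bounded in terms of `c`, so is the hybrid time
that a solution can spend above the level `a` (`exists_time_bound`). No invariance principle is
needed.

Together with the `𝒦∞` bounds of `V` in terms of the distance to `p₀`, obtained from properness and
continuity by regularization (`exists_isClassKInfty_le`), this gives stability and uniform
attractivity, and the `𝒦ℒ` bound is the supremum over all solutions (`exists_isClassKL`).
-/

/-! ### Absolutely continuous functions -/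

theorem AbsolutelyContinuousOnInterval.comp_lipschitzOnWith {X Y : Type*} [PseudoMetricSpace X]
    [PseudoMetricSpace Y] {f : ℝ → X} {g : X → Y} {K : NNReal} {s : Set X} {a b : ℝ}
    (hf : AbsolutelyContinuousOnInterval f a b) (hg : LipschitzOnWith K g s)
    (hs : MapsTo f (uIcc a b) s) :
    AbsolutelyContinuousOnInterval (fun t => g (f t)) a b := by
  rw [absolutelyContinuousOnInterval_iff] at hf ⊢
  intro ε hε
  obtain ⟨η, hη, h⟩ := hf (ε / (K + 1)) (by positivity)
  refine ⟨η, hη, fun E hE hlt => ?_⟩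
  have h1 := h E hE hlt
  have h2 : ∑ i ∈ Finset.range E.1, dist (g (f (E.2 i).1)) (g (f (E.2 i).2)) ≤
      K * ∑ i ∈ Finset.range E.1, dist (f (E.2 i).1) (f (E.2 i).2) := by
    rw [Finset.mul_sum]
    refine Finset.sum_le_sum fun i hi => ?_
    have := hE.1 i hi
    exact hg.dist_le_mul _ (hs this.1) _ (hs this.2)
  have h3 : (0 : ℝ) ≤ ∑ i ∈ Finset.range E.1, dist (f (E.2 i).1) (f (E.2 i).2) :=
    Finset.sum_nonneg fun _ _ => dist_nonneg
  have hK : (0 : ℝ) ≤ K := K.2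
  rw [lt_div_iff₀ (by positivity)] at h1
  nlinarith

theorem AbsolutelyContinuousOnInterval.sub_le_of_ae_hasDerivAt_le {f : ℝ → ℝ} {a b k : ℝ}
    (hab : a ≤ b) (hf : AbsolutelyContinuousOnInterval f a b)
    (h : ∀ᵐ s : ℝ, s ∈ Ioo a b → ∃ d ≤ k, HasDerivAt f d s) :
    f b - f a ≤ k * (b - a) := by
  rw [← hf.integral_deriv_eq_sub]
  have h1 : ∫ _ in a..b, k = k * (b - a) := by
    rw [intervalIntegral.integral_const, smul_eq_mul, mul_comm]
  rw [← h1]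
  refine intervalIntegral.integral_mono_ae_restrict hab hf.intervalIntegrable_deriv
    intervalIntegrable_const ?_
  rw [← Measure.restrict_congr_set Ioo_ae_eq_Icc]
  rw [EventuallyLE, ae_restrict_iff' measurableSet_Ioo]
  filter_upwards [h] with s hs hmem
  obtain ⟨d, hd, hD⟩ := hs hmem
  rwa [hD.deriv]

/-! ### Hybrid time domains -/

/-- The jump times up to a point `(T, J)` of a hybrid time domain, with the final time `T` as the
last entry. -/
theorem IsHybridTimeDomain.exists_times {E : Set (ℝ × ℕ)} (hE : IsHybridTimeDomain E) {T : ℝ}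
    {J : ℕ} (h : (T, J) ∈ E) :
    ∃ t : ℕ → ℝ, t 0 = 0 ∧ (∀ j ≤ J, t j ≤ t (j + 1)) ∧ t (J + 1) = T ∧
      ∀ s j, ((s, j) ∈ E ∧ s ≤ T ∧ j ≤ J) ↔ (j ≤ J ∧ s ∈ Icc (t j) (t (j + 1))) := by
  obtain ⟨J', t, -, h0, hmono, heq⟩ := hE.2.2 _ h
  have key : ∀ s j, ((s, j) ∈ E ∧ s ≤ T ∧ j ≤ J) ↔ (j < J' ∧ s ∈ Icc (t j) (t (j + 1))) := by
    intro s j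
    have := Set.ext_iff.1 heq (s, j)
    simp only [mem_inter_iff, mem_ofPred_eq, mem_Icc] at this
    constructor
    · rintro ⟨h1, h2, h3⟩
      exact this.1 ⟨h1, ⟨hE.2.1 _ h1, h2⟩, h3⟩
    · intro h1
      have := this.2 h1
      exact ⟨this.1, this.2.1.2, this.2.2⟩
  have h1 := (key T J).1 ⟨h, le_rfl, le_rfl⟩
  have h2 : J' = J + 1 := by
    by_contra hne
    have h3 : J + 1 < J' := by omega
    have := (key (t (J + 1)) (J + 1)).2 ⟨h3, le_rfl, hmono _ h3⟩
    omega
  subst h2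
  refine ⟨t, h0, fun j hj => hmono j (by omega), ?_, fun s j => ?_⟩
  · have := (key (t (J + 1)) J).2 ⟨by omega, hmono J (by omega), le_rfl⟩
    exact le_antisymm this.2.1 h1.2.2
  · rw [key, Nat.lt_succ_iff]

theorem IsHybridTimeDomain.zero_mem {E : Set (ℝ × ℕ)} (hE : IsHybridTimeDomain E) :
    ((0 : ℝ), 0) ∈ E := by
  obtain ⟨⟨T, J⟩, h⟩ := hE.1
  obtain ⟨t, h0, hmono, -, hmem⟩ := hE.exists_times h
  have h1 := hmono 0 (Nat.zero_le _)
  exact ((hmem 0 0).2 ⟨Nat.zero_le _, h0.le, h0 ▸ h1⟩).1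

/-- A quantity that falls at least at rate `k` along flows and by at least `k` at jumps, in the part
of the domain before `(T, J)`, falls by at least `k` per unit of hybrid time `t + j`. -/
theorem IsHybridTimeDomain.decrease {E : Set (ℝ × ℕ)} (hE : IsHybridTimeDomain E) {T : ℝ}
    {J : ℕ} (h : (T, J) ∈ E) (ℓ : ℝ → ℕ → ℝ) (k : ℝ)
    (hflow : ∀ j ≤ J, ∀ a b, a < b → b ≤ T → (∀ s ∈ Icc a b, (s, j) ∈ E) →
      ℓ b j + k * (b - a) ≤ ℓ a j)
    (hjump : ∀ t j, j < J → t ≤ T → (t, j) ∈ E → (t, j + 1) ∈ E → ℓ t (j + 1) + k ≤ ℓ t j)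
    {s : ℝ} {j : ℕ} (hs : (s, j) ∈ E) (hsT : s ≤ T) (hjJ : j ≤ J) :
    ℓ T J + k * (T + J) ≤ ℓ s j + k * (s + j) := by
  obtain ⟨t, h0, hmono, hlast, hmem⟩ := hE.exists_times h
  -- flow from `(s, i)` to the end of the interval containing it
  have hstep : ∀ i ≤ J, ∀ s ∈ Icc (t i) (t (i + 1)),
      ℓ (t (i + 1)) i + k * (t (i + 1) - s) ≤ ℓ s i := by
    intro i hi s hs
    rcases hs.2.eq_or_lt with heq | hlt
    · simp [heq]
    · refine hflow i hi _ _ hlt ?_ fun u hu => ((hmem u i).2 ⟨hi, hs.1.trans hu.1, hu.2⟩).1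
      exact ((hmem (t (i + 1)) i).2 ⟨hi, hmono i hi, le_rfl⟩).2.1
  have main : ∀ m i, i + m = J → ∀ s ∈ Icc (t i) (t (i + 1)),
      ℓ T J + k * (T + J) ≤ ℓ s i + k * (s + i) := by
    intro m
    induction m with
    | zero =>
      intro i hi s hs
      obtain rfl : i = J := by omega
      have := hstep i le_rfl s hs
      rw [hlast] at this
      linarith
    | succ m ih =>
      intro i hi s hs
      have h1 := hstep i (by omega) s hs
      have h2 := ih (i + 1) (by omega) (t (i + 1)) ⟨le_rfl, hmono _ (by omega)⟩
      have h3 := (hmem (t (i + 1)) i).2 ⟨by omega, hmono _ (by omega), le_rfl⟩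
      have h4 := (hmem (t (i + 1)) (i + 1)).2 ⟨by omega, le_rfl, hmono _ (by omega)⟩
      have h5 := hjump _ _ (by omega) h3.2.1 h3.1 h4.1
      push_cast at h2
      linarith
  exact main (J - j) j (by omega) s ((hmem s j).1 ⟨hs, hsT, hjJ⟩).2

namespace HybridSystem

variable {X : Type*} [NormedAddCommGroup X] [NormedSpace ℝ X] {H : HybridSystem X}
  {x : HybridArc X}

/-- A set that contains the flow set and the jump set and is mapped into itself by jumps contains
every value of every solution. -/
theorem IsSolution.mem_of_invariant (hx : H.IsSolution x) {Ω : Set X} (hC : H.flowSet ⊆ Ω)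
    (hD : H.jumpSet ⊆ Ω) (hG : ∀ ξ ∈ H.jumpSet, H.jumpMap ξ ⊆ Ω) {T : ℝ} {J : ℕ}
    (h : (T, J) ∈ x.dom) : x.val T J ∈ Ω := by
  obtain ⟨t, h0, hmono, hlast, hmem⟩ := x.isHybridTimeDomain.exists_times h
  rcases (hmono J le_rfl).eq_or_lt with heq | hlt
  · rw [hlast] at heq
    cases J with
    | zero =>
      rw [h0] at heq
      subst heq
      exact hx.initial.elim (fun h => hC h) (fun h => hD h)
    | succ J =>
      have h1 := (hmem T J).2 ⟨by omega, heq ▸ hmono J (by omega), heq.ge⟩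
      have h2 := hx.jump T J h1.1 h
      exact hG _ h2.1 h2.2
  · refine hC (hx.flow_mem J ⟨(t J + t (J + 1)) / 2, ?_⟩ T h)
    refine interior_mono (s := Icc (t J) (t (J + 1)))
      (fun s hs => ((hmem s J).2 ⟨le_rfl, hs⟩).1) ?_
    rw [interior_Icc]
    constructor <;> linarith

/-- A locally Lipschitz function whose derivative along the flow is at most `-k` falls at least at
rate `k` along the flow of a solution. -/
theorem IsSolution.flow_decrease (hx : H.IsSolution x) {ℓ : X → ℝ}
    (hℓ : LocallyLipschitzOn H.flowSet ℓ) {j : ℕ} {a b k : ℝ} (hab : a < b)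
    (hdom : ∀ s ∈ Icc a b, (s, j) ∈ x.dom)
    (hder : ∀ s ∈ Ioo a b, ∀ v ∈ H.flowMap (x.val s j),
      HasDerivAt (fun s => x.val s j) v s →
        ∃ d ≤ -k, HasDerivAt (fun s => ℓ (x.val s j)) d s) :
    ℓ (x.val b j) + k * (b - a) ≤ ℓ (x.val a j) := by
  have hint : (interior {t | (t, j) ∈ x.dom}).Nonempty := by
    refine ⟨(a + b) / 2, interior_mono (s := Icc a b) hdom ?_⟩
    rw [interior_Icc]
    constructor <;> linarith
  have hac := x.locallyAbsolutelyContinuous j hint a b (hdom a ⟨le_rfl, hab.le⟩)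
    (hdom b ⟨hab.le, le_rfl⟩)
  have hcomp : IsCompact ((fun s => x.val s j) '' Icc a b) := by
    refine isCompact_Icc.image_of_continuousOn ?_
    have := hac.continuousOn
    rwa [uIcc_of_le hab.le] at this
  have hsub : (fun s => x.val s j) '' Icc a b ⊆ H.flowSet := by
    rintro _ ⟨s, hs, rfl⟩
    exact hx.flow_mem j hint s (hdom s hs)
  obtain ⟨K, hK⟩ := (hℓ.mono hsub).exists_lipschitzOnWith_of_compact hcomp
  have hac' := hac.comp_lipschitzOnWith hK (by
    rw [uIcc_of_le hab.le]; exact mapsTo_image _ _)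
  have := hac'.sub_le_of_ae_hasDerivAt_le (k := -k) hab.le (by
    filter_upwards [hx.flow_deriv j hint] with s hs hmem
    obtain ⟨v, hv, hd⟩ := hs (hdom s ⟨hmem.1.le, hmem.2.le⟩)
    exact hder s hmem v hv hd)
  linarith

end HybridSystem

/-! ### Comparison functions -/

/-- The regularization `ρ ↦ ρ / (1 + ρ) * ⨅ i, (f i + (ρ - g i)⁺)`, whose second factor is
`1`-Lipschitz and nondecreasing, is a `𝒦∞` lower bound of `f` in terms of `g`. -/
theorem exists_isClassKInfty_le {ι : Type*} [Nonempty ι] {f g : ι → ℝ} (hf : ∀ i, 0 ≤ f i)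
    (hsmall : ∀ ε > 0, ∃ η > 0, ∀ i, ε ≤ g i → η ≤ f i)
    (hlarge : ∀ c, ∃ R, ∀ i, R ≤ g i → c ≤ f i) (hg : ∀ i, 0 ≤ g i) :
    ∃ α, IsClassKInfty α ∧ ∀ i, α (g i) ≤ f i := by
  set m : ℝ → ℝ := fun ρ => ⨅ i, (f i + max (ρ - g i) 0) with hm
  have hbdd : ∀ ρ, BddBelow (range fun i => f i + max (ρ - g i) 0) := fun ρ =>
    ⟨0, by rintro _ ⟨i, rfl⟩; exact add_nonneg (hf i) (le_max_right _ _)⟩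
  have hm_le : ∀ ρ i, m ρ ≤ f i + max (ρ - g i) 0 := fun ρ i => ciInf_le (hbdd ρ) i
  have hm_nonneg : ∀ ρ, 0 ≤ m ρ := fun ρ =>
    le_ciInf fun i => add_nonneg (hf i) (le_max_right _ _)
  have hm_mono : Monotone m := fun ρ ρ' h => ciInf_mono (hbdd ρ) fun i => by
    gcongr
  have hm_lip : LipschitzWith 1 m := by
    refine LipschitzWith.of_le_add fun ρ ρ' => ?_
    rw [← sub_le_iff_le_add]
    refine le_ciInf fun i => ?_
    rw [sub_le_iff_le_add]
    refine (hm_le ρ i).trans ?_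
    have h1 : ρ - ρ' ≤ dist ρ ρ' := le_abs_self _
    have h2 : max (ρ - g i) 0 ≤ max (ρ' - g i) 0 + dist ρ ρ' := by
      refine max_le ?_ (add_nonneg (le_max_right _ _) dist_nonneg)
      linarith [le_max_left (ρ' - g i) 0]
    linarith
  have hm_pos : ∀ ρ, 0 < ρ → 0 < m ρ := by
    intro ρ hρ
    obtain ⟨η, hη, h⟩ := hsmall (ρ / 2) (by positivity)
    refine lt_of_lt_of_le (lt_min hη (half_pos hρ)) (le_ciInf fun i => ?_)
    rcases le_total (ρ / 2) (g i) with h1 | h1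
    · exact (min_le_left _ _).trans ((h i h1).trans (le_add_of_nonneg_right (le_max_right _ _)))
    · refine (min_le_right _ _).trans ?_
      linarith [hf i, le_max_left (ρ - g i) 0]
  have hq_mono : ∀ ρ ρ' : ℝ, 0 ≤ ρ → ρ < ρ' → ρ / (1 + ρ) < ρ' / (1 + ρ') := by
    intro ρ ρ' h0 h1
    rw [div_lt_div_iff₀ (by linarith) (by linarith)]
    nlinarith
  refine ⟨fun ρ => ρ / (1 + ρ) * m ρ, ⟨?_, ?_, ?_, ?_⟩, fun i => ?_⟩
  · refine ContinuousOn.mul (ContinuousOn.div continuousOn_id (by fun_prop) ?_)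
      hm_lip.continuous.continuousOn
    intro ρ hρ
    have : (0 : ℝ) ≤ ρ := hρ
    positivity
  · intro ρ hρ ρ' hρ' h
    have h0 : (0 : ℝ) ≤ ρ := hρ
    have h1 : 0 < m ρ' := hm_pos ρ' (lt_of_le_of_lt h0 h)
    calc ρ / (1 + ρ) * m ρ ≤ ρ / (1 + ρ) * m ρ' := by
          have := hm_mono h.le
          gcongr
      _ < ρ' / (1 + ρ') * m ρ' := by
          have := hq_mono ρ ρ' h0 h
          gcongr
  · simp
  · refine tendsto_atTop.2 fun c => ?_
    obtain ⟨R, hR⟩ := hlarge (2 * |c|)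
    filter_upwards [eventually_ge_atTop 1, eventually_ge_atTop (R + 2 * |c|)] with ρ h1 h2
    have h3 : 2 * |c| ≤ m ρ := by
      refine le_ciInf fun i => ?_
      rcases le_total R (g i) with h | h
      · exact (hR i h).trans (le_add_of_nonneg_right (le_max_right _ _))
      · linarith [hf i, le_max_left (ρ - g i) 0]
    have h4 : 1 / 2 ≤ ρ / (1 + ρ) := by
      rw [div_le_div_iff₀ (by norm_num) (by linarith)]
      linarith
    have := mul_le_mul h4 h3 (by positivity) (le_trans (by norm_num) h4)
    linarith [le_abs_self c]
  · have h1 : m (g i) ≤ f i := by simpa using hm_le (g i) i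
    have h2 : g i / (1 + g i) ≤ 1 := by
      have := hg i
      rw [div_le_one (by linarith)]
      linarith
    calc g i / (1 + g i) * m (g i) ≤ 1 * m (g i) := by
          have := hm_nonneg (g i)
          gcongr
      _ ≤ f i := by linarith

/-- The inverse of a `𝒦∞` function, as a `𝒦∞` function. -/
theorem IsClassKInfty.exists_inverse {α : ℝ → ℝ} (hα : IsClassKInfty α) :
    ∃ β, IsClassKInfty β ∧ ∀ u v, 0 ≤ u → α u ≤ v → u ≤ β v := by
  -- extend `α` by the identity to an order isomorphism of `ℝ`
  set A : ℝ → ℝ := fun u => if 0 ≤ u then α u else u with hA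
  have hA_of : ∀ u, 0 ≤ u → A u = α u := fun u hu => if_pos hu
  have hA_neg : ∀ u, u < 0 → A u = u := fun u hu => if_neg (not_le.2 hu)
  have hnn : ∀ u, 0 ≤ u → 0 ≤ α u := fun u hu => by
    have := hα.strictMonoOn.monotoneOn (mem_Ici.2 le_rfl) (mem_Ici.2 hu) hu
    rwa [hα.zero] at this
  have hmono : StrictMono A := by
    intro u v huv
    rcases lt_or_ge u 0 with hu | hu
    · rw [hA_neg u hu]
      rcases lt_or_ge v 0 with hv | hv
      · rwa [hA_neg v hv]
      · rw [hA_of v hv]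
        exact hu.trans_le (hnn v hv)
    · rw [hA_of u hu, hA_of v (hu.trans huv.le)]
      exact hα.strictMonoOn hu (mem_Ici.2 (hu.trans huv.le)) huv
  have hsurj : Function.Surjective A := by
    intro v
    rcases lt_or_ge v 0 with hv | hv
    · exact ⟨v, hA_neg v hv⟩
    · obtain ⟨R, hR, hR0⟩ :=
        ((hα.tendsto_atTop.eventually_ge_atTop v).and (eventually_ge_atTop 0)).exists
      obtain ⟨u, hu, hu'⟩ := intermediate_value_Icc hR0
        (hα.continuousOn.mono Icc_subset_Ici_self) ⟨hα.zero.trans_le hv, hR⟩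
      exact ⟨u, (hA_of u hu.1).trans hu'⟩
  set e := hmono.orderIsoOfSurjective A hsurj with he
  have heA : ∀ u, e u = A u := fun u => rfl
  refine ⟨e.symm, ⟨e.symm.continuous.continuousOn, e.symm.strictMono.strictMonoOn _, ?_,
    e.symm.tendsto_atTop⟩, fun u v hu h => ?_⟩
  · rw [OrderIso.symm_apply_eq, heA, hA_of 0 le_rfl, hα.zero]
  · rw [OrderIso.le_symm_apply, heA, hA_of u hu]
    exact h

/-- The `𝒦ℒ` bound is the supremum of the distances `d i` reached after time `s`
from initial distances at most `r`. -/
theorem exists_isClassKL {ι : Type*} (r s d : ι → ℝ)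
    (hbdd : ∀ ρ, ∃ R, ∀ i, r i ≤ ρ → d i ≤ R)
    (hstab : ∀ ε > 0, ∃ η > 0, ∀ i, r i ≤ η → d i ≤ ε)
    (hattr : ∀ ρ, ∀ ε > 0, ∃ T, ∀ i, r i ≤ ρ → T ≤ s i → d i ≤ ε) :
    ∃ β, IsClassKL β ∧ ∀ i, d i ≤ β (r i) (s i) := by
  set S : ℝ → ℝ → Set ℝ := fun ρ T => insert 0 (d '' {i | r i ≤ ρ ∧ T ≤ s i}) with hS
  have hSb : ∀ ρ T, BddAbove (S ρ T) := by
    intro ρ T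
    obtain ⟨R, hR⟩ := hbdd ρ
    refine BddAbove.insert 0 ⟨R, ?_⟩
    rintro _ ⟨i, hi, rfl⟩
    exact hR i hi.1
  have hS0 : ∀ ρ T, 0 ≤ sSup (S ρ T) := fun ρ T => le_csSup (hSb ρ T) (mem_insert _ _)
  have hSle : ∀ ρ T ε, 0 ≤ ε → (∀ i, r i ≤ ρ → T ≤ s i → d i ≤ ε) → sSup (S ρ T) ≤ ε := by
    intro ρ T ε hε h
    refine csSup_le (insert_nonempty _ _) ?_
    rintro _ (rfl | ⟨i, hi, rfl⟩)
    · exact hε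
    · exact h i hi.1 hi.2
  have hanti : ∀ ρ, Antitone fun T => sSup (S ρ T) := fun ρ T T' h =>
    csSup_le_csSup (hSb ρ T) (insert_nonempty _ _)
      (insert_subset_insert (image_mono fun i hi => ⟨hi.1, h.trans hi.2⟩))
  have hmono : ∀ T, Monotone fun ρ => sSup (S ρ T) := fun T ρ ρ' h =>
    csSup_le_csSup (hSb ρ' T) (insert_nonempty _ _)
      (insert_subset_insert (image_mono fun i hi => ⟨hi.1.trans h, hi.2⟩))
  refine ⟨fun ρ T => sSup (S ρ T), ⟨fun ρ T _ _ => hS0 ρ T, fun T _ => (hmono T).monotoneOn _,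
    fun ρ _ => (hanti ρ).antitoneOn _, fun T _ => ?_, fun ρ _ => ?_⟩, fun i => ?_⟩
  · refine Metric.tendsto_nhds.2 fun ε hε => ?_
    obtain ⟨η, hη, h⟩ := hstab (ε / 2) (half_pos hε)
    filter_upwards [mem_nhdsWithin_of_mem_nhds (Iio_mem_nhds hη)] with ρ hρ
    have := hSle ρ T (ε / 2) (half_pos hε).le fun i hi _ => h i (hi.trans (le_of_lt hρ))
    rw [Real.dist_0_eq_abs, abs_of_nonneg (hS0 ρ T)]
    linarith
  · refine Metric.tendsto_nhds.2 fun ε hε => ?_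
    obtain ⟨T₁, h⟩ := hattr ρ (ε / 2) (half_pos hε)
    filter_upwards [eventually_ge_atTop T₁] with T hT
    have := hSle ρ T (ε / 2) (half_pos hε).le fun i hi hi' => h i hi (le_trans hT hi')
    rw [Real.dist_0_eq_abs, abs_of_nonneg (hS0 ρ T)]
    linarith
  · exact le_csSup (hSb _ _) (mem_insert_of_mem _ ⟨i, ⟨le_rfl, le_rfl⟩, rfl⟩)

/-! ### Tangent spaces and ambient gradients -/

theorem Submodule.hasDerivAt_mem {E : Type*} [NormedAddCommGroup E] [NormedSpace ℝ E]
    [FiniteDimensional ℝ E] (S : Submodule ℝ E) {h : ℝ → E} {w : E} {a : ℝ}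
    (hd : HasDerivAt h w a) (hS : ∀ᶠ t in 𝓝 a, h t ∈ S) : w ∈ S := by
  refine S.closed_of_finiteDimensional.mem_of_tendsto (hasDerivAt_iff_tendsto_slope.1 hd) ?_
  filter_upwards [mem_nhdsWithin_of_mem_nhds hS] with t ht
  rw [slope_def_module]
  exact S.smul_mem _ (S.sub_mem ht hS.self_of_nhds)

/-- In a chart `Φ` that straightens `M` to a linear subspace `S`, the tangent space at `p` is the
preimage of `S` under the derivative of `Φ`. -/
theorem IsSmoothSubmanifold.exists_submodule_eq_tangentVectors {E : Type*} [NormedAddCommGroup E]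
    [NormedSpace ℝ E] [FiniteDimensional ℝ E] {d : ℕ} {M : Set E} (hM : IsSmoothSubmanifold d M)
    {p : E} (hp : p ∈ M) : ∃ T : Submodule ℝ E, (T : Set E) = tangentVectors M p := by
  obtain ⟨Φ, S, -, hpΦ, hΦ, hΨ, hΦM⟩ := hM p hp
  have hpt : Φ p ∈ Φ.target := Φ.map_source hpΦ
  have hpS : Φ p ∈ S := (hΦM.subset (mem_image_of_mem Φ ⟨hpΦ, hp⟩)).2
  have hdΦ : HasFDerivAt Φ (fderiv ℝ Φ p) p :=
    ((hΦ.contDiffAt (Φ.open_source.mem_nhds hpΦ)).differentiableAt (by simp)).hasFDerivAt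
  have hdΨ : HasFDerivAt Φ.symm (fderiv ℝ Φ.symm (Φ p)) (Φ p) :=
    ((hΨ.contDiffAt (Φ.open_target.mem_nhds hpt)).differentiableAt (by simp)).hasFDerivAt
  have hinv : ∀ v, fderiv ℝ Φ.symm (Φ p) (fderiv ℝ Φ p v) = v := by
    have h1 := (hdΨ.comp p hdΦ).congr_of_eventuallyEq (f₁ := id) (by
      filter_upwards [Φ.open_source.mem_nhds hpΦ] with x hx using (Φ.left_inv hx).symm)
    intro v
    exact congrArg (fun L : E →L[ℝ] E => L v) (h1.unique (hasFDerivAt_id p))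
  refine ⟨S.comap (fderiv ℝ Φ p : E →ₗ[ℝ] E), Subset.antisymm (fun v hv => ?_) ?_⟩
  · have hv : fderiv ℝ Φ p v ∈ S := hv
    have hline : HasDerivAt (fun t : ℝ => Φ p + t • fderiv ℝ Φ p v) (fderiv ℝ Φ p v) 0 := by
      simpa using ((hasDerivAt_id (0 : ℝ)).smul_const (fderiv ℝ Φ p v)).const_add (Φ p)
    refine ⟨fun t => Φ.symm (Φ p + t • fderiv ℝ Φ p v), ?_, ?_, ?_⟩
    · have hT : ∀ᶠ t : ℝ in 𝓝 0, Φ p + t • fderiv ℝ Φ p v ∈ Φ.target :=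
        hline.continuousAt.eventually_mem (Φ.open_target.mem_nhds (by simpa using hpt))
      filter_upwards [hT] with t ht
      obtain ⟨m, hm, hmt⟩ := hΦM.superset ⟨ht, S.add_mem hpS (S.smul_mem t hv)⟩
      rw [← hmt, Φ.left_inv hm.1]
      exact hm.2
    · simpa using Φ.left_inv hpΦ
    · have h0 : HasFDerivAt Φ.symm (fderiv ℝ Φ.symm (Φ p))
          (Φ p + (0 : ℝ) • fderiv ℝ Φ p v) := by simpa using hdΨ
      have := h0.comp_hasDerivAt (0 : ℝ) hline
      rwa [hinv] at this
  · rintro v ⟨c, hcM, hc0, hc⟩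
    have hΦc : HasDerivAt (fun t => Φ (c t)) (fderiv ℝ Φ p v) 0 :=
      (hc0 ▸ hdΦ : HasFDerivAt Φ (fderiv ℝ Φ p) (c 0)).comp_hasDerivAt (0 : ℝ) hc
    refine S.hasDerivAt_mem hΦc ?_
    filter_upwards [hcM, hc.continuousAt.eventually_mem
      (Φ.open_source.mem_nhds (hc0 ▸ hpΦ))] with t h1 h2
    exact (hΦM.subset (mem_image_of_mem Φ ⟨h2, h1⟩)).2

section Gradients

variable {X : Type*} [NormedAddCommGroup X] [InnerProductSpace ℝ X] [CompleteSpace X]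

/-- The chain rule along a curve in `S`, for a function of class `C¹` on `S`. -/
theorem hasDerivAt_comp_of_mem_ambientGradients {V : X → ℝ} {S : Set X} {c : ℝ → X} {a : ℝ}
    {g v : X} (hg : g ∈ ambientGradients V S (c a)) (hS : ∀ᶠ t in 𝓝 a, c t ∈ S)
    (hc : HasDerivAt c v a) : HasDerivAt (fun t => V (c t)) (inner ℝ g v) a := by
  obtain ⟨U, W, hU, hxU, hW, hWV, rfl⟩ := hg
  have hd : HasFDerivAt W (fderiv ℝ W (c a)) (c a) :=
    ((hW.1.contDiffAt (hU.mem_nhds hxU)).differentiableAt (by simp)).hasFDerivAt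
  have h1 := hd.comp_hasDerivAt a hc
  rw [inner_gradient_left]
  refine h1.congr_of_eventuallyEq ?_
  filter_upwards [hS, hc.continuousAt.eventually_mem (hU.mem_nhds hxU)] with t h2 h3
  exact (hWV ⟨h3, h2⟩).symm

theorem IsC1LipOn.locallyLipschitzOn {Y Z : Type*} [NormedAddCommGroup Y] [NormedSpace ℝ Y]
    [NormedAddCommGroup Z] [NormedSpace ℝ Z] {V : Y → Z} {S : Set Y} (h : IsC1LipOn V S) :
    LocallyLipschitzOn S V := by
  intro x hx
  obtain ⟨U, W, hU, hxU, hW, hWV⟩ := h x hx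
  obtain ⟨K, t, ht, hK⟩ := (hW.1.contDiffAt (hU.mem_nhds hxU)).exists_lipschitzOnWith
  refine ⟨K, t ∩ U ∩ S, inter_mem (mem_nhdsWithin_of_mem_nhds (inter_mem ht (hU.mem_nhds hxU)))
    self_mem_nhdsWithin, fun y hy z hz => ?_⟩
  rw [← hWV ⟨hy.1.2, hy.2⟩, ← hWV ⟨hz.1.2, hz.2⟩]
  exact hK hy.1.1 hz.1.1

theorem IsC1LipOn.nonempty_ambientGradients {V : X → ℝ} {S : Set X} (h : IsC1LipOn V S) {x : X}
    (hx : x ∈ S) : (ambientGradients V S x).Nonempty := by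
  obtain ⟨U, W, hU, hxU, hW, hWV⟩ := h x hx
  exact ⟨_, U, W, hU, hxU, hW, hWV, rfl⟩

/-- The pairing of the gradient with a tangent vector does not depend on the local extension. -/
theorem inner_eq_of_mem_ambientGradients {V : X → ℝ} {S : Set X} {p g g' v : X}
    (hg : g ∈ ambientGradients V S p) (hg' : g' ∈ ambientGradients V S p)
    (hv : v ∈ tangentVectors S p) : (inner ℝ g v : ℝ) = inner ℝ g' v := by
  obtain ⟨c, hcS, rfl, hc⟩ := hv
  exact (hasDerivAt_comp_of_mem_ambientGradients hg hcS hc).unique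
    (hasDerivAt_comp_of_mem_ambientGradients hg' hcS hc)

end Gradients

/-- If `∇V` is orthogonal to all of the `b i`, it is orthogonal to the tangent space, because the
lower bound on `∑ i, ⟨b i, v⟩²` makes the `b i` span it. -/
theorem mem_critSet_of_inner_eq_zero {E ι : Type*} [NormedAddCommGroup E] [InnerProductSpace ℝ E]
    [FiniteDimensional ℝ E] [Fintype ι] {d : ℕ} {M : Set E} (hM : IsSmoothSubmanifold d M)
    {b : ι → E → E} {p : E} (hp : p ∈ M) (hbT : ∀ i, b i p ∈ tangentVectors M p) {lam : ℝ}
    (hlam : 0 < lam)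
    (hspan : ∀ v ∈ tangentVectors M p, lam * inner ℝ v v ≤ ∑ i, (inner ℝ (b i p) v) ^ 2)
    {V : E → ℝ} {g : E} (hg : g ∈ ambientGradients V M p) (h0 : ∀ i, inner ℝ g (b i p) = (0 : ℝ)) :
    p ∈ critSet M V := by
  obtain ⟨T, hT⟩ := hM.exists_submodule_eq_tangentVectors hp
  refine ⟨hp, g, hg, fun v hv => ?_⟩
  set B := Submodule.span ℝ (range fun i => b i p) with hB
  have hBT : B ≤ T := by
    rw [hB, Submodule.span_le, hT]
    rintro _ ⟨i, rfl⟩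
    exact hbT i
  obtain ⟨y, hy, z, hz, rfl⟩ := B.exists_add_mem_mem_orthogonal v
  have hzT : z ∈ tangentVectors M p := by
    have hvT : y + z ∈ T := by rw [← SetLike.mem_coe, hT]; exact hv
    rw [← hT]
    simpa using T.sub_mem hvT (hBT hy)
  have hz0 : z = 0 := by
    have h1 := hspan z hzT
    have h2 : ∑ i, (inner ℝ (b i p) z : ℝ) ^ 2 = 0 := Finset.sum_eq_zero fun i _ => by
      rw [(Submodule.mem_orthogonal B z).1 hz _ (Submodule.subset_span ⟨i, rfl⟩)]
      simp
    rw [h2, real_inner_self_eq_norm_sq] at h1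
    have : ‖z‖ ^ 2 ≤ 0 := by nlinarith
    simpa using this
  rw [hz0, add_zero]
  have hle : B ≤ LinearMap.ker (innerₛₗ ℝ g) := by
    rw [hB, Submodule.span_le]
    rintro _ ⟨i, rfl⟩
    simpa using h0 i
  simpa using hle hy

/-! ### Synergistic families -/

theorem Set.Finite.exists_pos_forall_le {ι : Type*} {s : Set ι} (hs : s.Finite) {f : ι → ℝ}
    (hf : ∀ i ∈ s, 0 < f i) : ∃ e > 0, ∀ i ∈ s, e ≤ f i := by
  rcases s.eq_empty_or_nonempty with rfl | hne
  · exact ⟨1, one_pos, by simp⟩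
  · obtain ⟨i, hi, h⟩ := exists_min_image s f hs hne
    exact ⟨f i, hf i hi, h⟩

section Potentials

variable {E : Type*} {N : ℕ} {V : ℕ → E → ℝ} {p : E}

theorem minPotential_le {q : ℕ} (hq : q ∈ Icc 1 N) : minPotential N V p ≤ V q p :=
  csInf_le ((finite_Icc 1 N).image _).bddBelow (mem_image_of_mem _ hq)

theorem exists_eq_minPotential (hN : 1 ≤ N) : ∃ q ∈ Icc 1 N, V q p = minPotential N V p :=
  (((nonempty_Icc.2 hN).image _).csInf_mem ((finite_Icc 1 N).image _))

theorem sub_minPotential_le_iff (hN : 1 ≤ N) {q : ℕ} {δ : ℝ} :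
    V q p - minPotential N V p ≤ δ ↔ ∀ q' ∈ Icc 1 N, V q p - V q' p ≤ δ := by
  constructor
  · intro h q' hq'
    linarith [minPotential_le (V := V) (p := p) hq']
  · intro h
    obtain ⟨q', hq', heq⟩ := exists_eq_minPotential (V := V) (p := p) hN
    exact heq ▸ h q' hq'

theorem eq_minPotential_of_isMinOn {q : ℕ} (hq : q ∈ Icc 1 N)
    (h : IsMinOn (fun q' => V q' p) (Icc 1 N) q) : V q p = minPotential N V p := by
  refine le_antisymm (le_csInf ⟨_, mem_image_of_mem _ hq⟩ ?_) (minPotential_le hq)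
  rintro _ ⟨q', hq', rfl⟩
  exact h hq'

end Potentials

namespace IsSynergisticFamily

variable {E : Type*} [NormedAddCommGroup E] [InnerProductSpace ℝ E] [FiniteDimensional ℝ E]
  {M : Set E} {p₀ : E} {N : ℕ} {V : ℕ → E → ℝ} {δ : ℝ}

theorem continuousOn (hV : IsSynergisticFamily M p₀ N V δ) {q : ℕ} (hq : q ∈ Icc 1 N) :
    ContinuousOn (V q) M :=
  (hV.isC1 q hq).locallyLipschitzOn.continuousOn

theorem nonneg (hV : IsSynergisticFamily M p₀ N V δ) {q : ℕ} (hq : q ∈ Icc 1 N) {p : E}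
    (hp : p ∈ M) : 0 ≤ V q p := by
  by_cases h : p = p₀
  · rw [h, hV.zero q hq]
  · exact (hV.pos q hq p hp h).le

/-- By compactness of a sublevel set, `V_q` is bounded away from zero outside of each ball around
`p₀`. -/
theorem exists_pos_le_of_le_dist (hV : IsSynergisticFamily M p₀ N V δ) {q : ℕ}
    (hq : q ∈ Icc 1 N) {ε : ℝ} (hε : 0 < ε) :
    ∃ η > 0, ∀ p ∈ M, ε ≤ dist p p₀ → η ≤ V q p := by
  set K := {p | p ∈ M ∧ V q p ≤ 1} ∩ {p | ε ≤ dist p p₀} with hK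
  have hKc : IsCompact K := (hV.compact_sublevel q hq 1 zero_le_one).inter_right
    (isClosed_le continuous_const (by fun_prop))
  have hKM : K ⊆ M := fun p hp => hp.1.1
  rcases K.eq_empty_or_nonempty with hne | hne
  · refine ⟨1, one_pos, fun p hp h => ?_⟩
    by_contra! hlt
    exact (hne ▸ (⟨⟨hp, hlt.le⟩, h⟩ : p ∈ K) : p ∈ (∅ : Set E))
  · obtain ⟨m, hm, hmin⟩ := hKc.exists_isMinOn hne ((hV.continuousOn hq).mono hKM)
    have hmp : m ≠ p₀ := by
      rintro rfl
      have : ε ≤ dist m m := hm.2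
      rw [dist_self] at this
      linarith
    refine ⟨V q m, hV.pos q hq m (hKM hm) hmp, fun p hp h => ?_⟩
    rcases le_total (V q p) 1 with h1 | h1
    · exact hmin ⟨⟨hp, h1⟩, h⟩
    · exact hm.1.2.trans h1

theorem exists_forall_le_of_le_dist (hV : IsSynergisticFamily M p₀ N V δ) {q : ℕ}
    (hq : q ∈ Icc 1 N) (c : ℝ) : ∃ R, ∀ p ∈ M, R ≤ dist p p₀ → c ≤ V q p := by
  obtain ⟨R, hR⟩ := (hV.compact_sublevel q hq |c| (abs_nonneg c)).isBounded.subset_closedBall p₀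
  refine ⟨R + 1, fun p hp h => ?_⟩
  by_contra! hlt
  have : dist p p₀ ≤ R := hR ⟨hp, hlt.le.trans (le_abs_self c)⟩
  linarith

theorem exists_pos_le_dist_of_le (hV : IsSynergisticFamily M p₀ N V δ) {q : ℕ}
    (hq : q ∈ Icc 1 N) {ε : ℝ} (hε : 0 < ε) :
    ∃ η > 0, ∀ p ∈ M, ε ≤ V q p → η ≤ dist p p₀ := by
  obtain ⟨η, hη, h⟩ := Metric.continuousWithinAt_iff.1 (hV.continuousOn hq p₀ hV.mem) ε hε
  refine ⟨η, hη, fun p hp hle => ?_⟩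
  by_contra! hlt
  have := h hp hlt
  rw [hV.zero q hq, Real.dist_0_eq_abs] at this
  linarith [le_abs_self (V q p)]

theorem exists_forall_le_dist_of_le (hV : IsSynergisticFamily M p₀ N V δ) (hMc : IsClosed M) {q : ℕ}
    (hq : q ∈ Icc 1 N) (c : ℝ) : ∃ R, ∀ p ∈ M, R ≤ V q p → c ≤ dist p p₀ := by
  obtain ⟨R, hR⟩ := ((isCompact_closedBall p₀ c).inter_left hMc).bddAbove_image
    ((hV.continuousOn hq).mono inter_subset_left)
  refine ⟨R + 1, fun p hp h => ?_⟩
  by_contra! hlt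
  have : V q p ≤ R := hR (mem_image_of_mem _ ⟨hp, hlt.le⟩)
  linarith

/-- On the compact set `{a ≤ V_q ≤ c, V_q - min V ≤ δ}`, which contains no critical point of `V_q`,
the sum of squares `∑ i, ⟨∇V_q, b_i⟩²` is bounded away from zero. -/
theorem exists_pos_le_sum_inner_sq {d : ℕ} {ι : Type*} [Fintype ι]
    (hV : IsSynergisticFamily M p₀ N V δ) (hM : IsSmoothSubmanifold d M) {b : ι → E → E}
    (hb : ∀ i, IsC1LipOn (b i) M) (hbT : ∀ i, ∀ p ∈ M, b i p ∈ tangentVectors M p) {lam : ℝ}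
    (hlam : 0 < lam)
    (hspan : ∀ p ∈ M, ∀ v ∈ tangentVectors M p,
      lam * inner ℝ v v ≤ ∑ i, (inner ℝ (b i p) v) ^ 2)
    {q : ℕ} (hq : q ∈ Icc 1 N) {a : ℝ} (ha : 0 < a) (c : ℝ) :
    ∃ w > 0, ∀ p ∈ M, a ≤ V q p → V q p ≤ c → V q p - minPotential N V p ≤ δ →
      ∀ g ∈ ambientGradients (V q) M p, w ≤ ∑ i, (inner ℝ g (b i p) : ℝ) ^ 2 := by
  set S := {p | p ∈ M ∧ V q p ≤ |c|} with hS
  have hSM : S ⊆ M := fun p hp => hp.1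
  have hSc : IsCompact S := hV.compact_sublevel q hq |c| (abs_nonneg c)
  have hqS := (hV.continuousOn hq).mono hSM
  set K := {p ∈ S | a ≤ V q p} ∩ ⋂ q' ∈ Icc 1 N, {p ∈ S | V q p - V q' p ≤ δ} with hK
  have hKc : IsCompact K := by
    refine hSc.of_isClosed_subset (IsClosed.inter ?_ (isClosed_biInter fun q' hq' => ?_))
      fun p hp => hp.1.1
    · exact hSc.isClosed.isClosed_le continuousOn_const hqS
    · exact hSc.isClosed.isClosed_le (hqS.sub ((hV.continuousOn hq').mono hSM)) continuousOn_const
  -- the bound holds locally, by continuity of the gradient of a local extension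
  have hloc : ∀ p ∈ K, ∃ t ∈ 𝓝[K] p, ∃ w > 0, ∀ p' ∈ t ∩ K,
      ∀ g ∈ ambientGradients (V q) M p', w ≤ ∑ i, (inner ℝ g (b i p') : ℝ) ^ 2 := by
    intro p hp
    have hpM : p ∈ M := hSM hp.1.1
    obtain ⟨U, W, hU, hpU, hW, hWV⟩ := hV.isC1 q hq p hpM
    have hgrad : ∀ p' ∈ U, gradient W p' ∈ ambientGradients (V q) M p' := fun p' hp' =>
      ⟨U, W, hU, hp', hW, hWV, rfl⟩
    set h : E → ℝ := fun p' => ∑ i, (fderiv ℝ W p' (b i p')) ^ 2 with hh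
    have hcont : ContinuousWithinAt h M p := by
      have h1 : ContinuousWithinAt (fderiv ℝ W) M p :=
        ((hW.1.continuousOn_fderiv_of_isOpen hU le_rfl).continuousAt
          (hU.mem_nhds hpU)).continuousWithinAt
      have h2 : ∀ i, ContinuousWithinAt (b i) M p := fun i =>
        (hb i).locallyLipschitzOn.continuousOn p hpM
      exact tendsto_finsetSum _ fun i _ => ((h1.clm_apply (h2 i)).pow 2)
    -- otherwise `p` is critical, and the synergy gap excludes it from `K`
    have hpos : 0 < h p := by
      by_contra hle
      have hz : ∀ i, inner ℝ (gradient W p) (b i p) = (0 : ℝ) := by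
        have h0 : h p = 0 :=
          le_antisymm (not_lt.1 hle) (Finset.sum_nonneg fun i _ => sq_nonneg _)
        intro i
        rw [inner_gradient_left]
        have := (Finset.sum_eq_zero_iff_of_nonneg fun i _ => sq_nonneg _).1 h0 i
          (Finset.mem_univ i)
        simpa using this
      have hcrit := mem_critSet_of_inner_eq_zero hM hpM (fun i => hbT i p hpM) hlam (hspan p hpM)
        (hgrad p hpU) hz
      have hne : p ≠ p₀ := by
        rintro rfl
        have : a ≤ V q p := hp.1.2
        rw [hV.zero q hq] at this
        linarith
      have h1 := hV.gap q hq p hcrit hne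
      have h2 := (sub_minPotential_le_iff (V := V) hV.one_le).2 fun q' hq' =>
        (mem_iInter₂.1 hp.2 q' hq').2
      linarith
    refine ⟨{p' | h p / 2 < h p'} ∩ U, inter_mem ?_ (mem_nhdsWithin_of_mem_nhds (hU.mem_nhds hpU)),
      h p / 2, half_pos hpos, fun p' hp' g hg => ?_⟩
    · exact nhdsWithin_mono p (fun p' hp' => hSM hp'.1.1)
        (hcont.eventually_mem (Ioi_mem_nhds (half_lt_self hpos)))
    · have hp'M : p' ∈ M := hSM hp'.2.1.1
      refine (le_of_lt hp'.1.1).trans_eq (Finset.sum_congr rfl fun i _ => ?_)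
      rw [inner_eq_of_mem_ambientGradients hg (hgrad p' hp'.1.2) (hbT i p' hp'M),
        inner_gradient_left]
  have hglob : ∃ w > 0, ∀ p' ∈ K,
      ∀ g ∈ ambientGradients (V q) M p', w ≤ ∑ i, (inner ℝ g (b i p') : ℝ) ^ 2 := by
    choose! t ht w hw hle using hloc
    obtain ⟨F, hFK, hF⟩ := hKc.elim_nhdsWithin_subcover t ht
    obtain ⟨e, he, hew⟩ := F.finite_toSet.exists_pos_forall_le fun p hp => hw p (hFK p hp)
    refine ⟨e, he, fun p' hp' g hg => ?_⟩
    obtain ⟨p, hpF, hpt⟩ := mem_iUnion₂.1 (hF hp')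
    exact (hew p hpF).trans (hle p (hFK p hpF) p' ⟨hpt, hp'⟩ g hg)
  obtain ⟨w, hw, h⟩ := hglob
  refine ⟨w, hw, fun p hp h1 h2 h3 g hg => h p ⟨?_, mem_iInter₂.2 fun q' hq' => ?_⟩ g hg⟩
  · exact ⟨⟨hp, h2.trans (le_abs_self c)⟩, h1⟩
  · exact ⟨⟨hp, h2.trans (le_abs_self c)⟩, (sub_minPotential_le_iff hV.one_le).1 h3 q' hq'⟩

end IsSynergisticFamily

/-! ### The potential on the product with the modes -/

theorem IsC1Lip.comp_clm {X Y Z : Type*} [NormedAddCommGroup X] [NormedSpace ℝ X]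
    [NormedAddCommGroup Y] [NormedSpace ℝ Y] [NormedAddCommGroup Z] [NormedSpace ℝ Z]
    {W : Y → Z} {U : Set Y} (hU : IsOpen U) (hW : IsC1Lip W U) (L : X →L[ℝ] Y) :
    IsC1Lip (fun x => W (L x)) (L ⁻¹' U) := by
  refine ⟨hW.1.comp L.contDiff.contDiffOn (mapsTo_preimage _ _), fun x hx => ?_⟩
  obtain ⟨K, t, ht, hK⟩ := hW.2 hx
  refine ⟨‖L‖₊ * (K * ‖L‖₊), L ⁻¹' t ∩ L ⁻¹' U, inter_mem
    (L.continuous.continuousWithinAt.preimage_mem_nhdsWithin' ?_) self_mem_nhdsWithin, ?_⟩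
  · exact nhdsWithin_mono _ (image_preimage_subset _ _) ht
  · have hfd : ∀ y ∈ L ⁻¹' U, fderiv ℝ (fun x => W (L x)) y = (fderiv ℝ W (L y)).comp L :=
      fun y hy => (((hW.1.contDiffAt (hU.mem_nhds hy)).differentiableAt
        (by simp)).hasFDerivAt.comp y L.hasFDerivAt).fderiv
    refine LipschitzOnWith.of_dist_le_mul fun y hy z hz => ?_
    rw [hfd y hy.2, hfd z hz.2, dist_eq_norm, ← ContinuousLinearMap.sub_comp]
    have h1 := hK.dist_le_mul _ hy.1 _ hz.1
    rw [dist_eq_norm] at h1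
    calc ‖(fderiv ℝ W (L y) - fderiv ℝ W (L z)).comp L‖
        ≤ ‖fderiv ℝ W (L y) - fderiv ℝ W (L z)‖ * ‖L‖ := ContinuousLinearMap.opNorm_comp_le _ _
      _ ≤ K * (‖L‖ * dist y z) * ‖L‖ := by
          have h2 := L.lipschitz.dist_le_mul y z
          gcongr
          refine h1.trans ?_
          gcongr
          exact h2
      _ = _ := by push_cast; ring

section ModeProduct

variable {n N : ℕ} {M : Set (EuclideanSpace ℝ (Fin n))} {p₀ : EuclideanSpace ℝ (Fin n)}
  {V : ℕ → EuclideanSpace ℝ (Fin n) → ℝ} {δ : ℝ}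

theorem synergisticPotential_eq {x : PlantState n} {q : ℕ} (hq : x.snd = (q : ℝ)) :
    synergisticPotential V x = V q x.fst := by
  rw [synergisticPotential, hq, Nat.floor_natCast]

theorem dist_plantState_eq {x y : PlantState n} (h : x.snd = y.snd) :
    dist x y = dist x.fst y.fst := by
  rw [WithLp.prod_dist_eq_of_L2, h, dist_self]
  simp

theorem HasDerivAt.toLp_prodMk {E F : Type*} [NormedAddCommGroup E] [NormedSpace ℝ E]
    [NormedAddCommGroup F] [NormedSpace ℝ F] {c : ℝ → E} {c' : ℝ → F} {v : E} {w : F} {a : ℝ}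
    (h : HasDerivAt c v a) (h' : HasDerivAt c' w a) :
    HasDerivAt (fun t => WithLp.toLp 2 (c t, c' t)) (WithLp.toLp 2 (v, w)) a :=
  ((WithLp.prodContinuousLinearEquiv 2 ℝ E F).symm : E × F →L[ℝ] WithLp 2 (E × F)).hasFDerivAt
    |>.comp_hasDerivAt a (h.prodMk h')

theorem IsCompact.withLp_prod {X P : Type*} [TopologicalSpace X] [TopologicalSpace P] {s : Set X}
    {t : Set P} (hs : IsCompact s) (ht : IsCompact t) :
    IsCompact {ξ : WithLp 2 (X × P) | ξ.fst ∈ s ∧ ξ.snd ∈ t} :=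
  (WithLp.homeomorphProd 2 X P).isCompact_preimage.2 (hs.prod ht)

/-- The chain rule along a curve on which the second component is constant. -/
theorem hasDerivAt_comp_toLp_of_mem_ambientGradients {E F : Type*} [NormedAddCommGroup E]
    [InnerProductSpace ℝ E] [CompleteSpace E] [NormedAddCommGroup F] [InnerProductSpace ℝ F]
    [CompleteSpace F] {V : WithLp 2 (E × F) → ℝ} {S : Set (WithLp 2 (E × F))} {c : ℝ → E} {y : F}
    {a : ℝ} {g : WithLp 2 (E × F)} {v : E}
    (hg : g ∈ ambientGradients V S (WithLp.toLp 2 (c a, y)))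
    (hS : ∀ᶠ t in 𝓝 a, WithLp.toLp 2 (c t, y) ∈ S) (hc : HasDerivAt c v a) :
    HasDerivAt (fun t => V (WithLp.toLp 2 (c t, y))) (inner ℝ g (WithLp.toLp 2 (v, 0))) a :=
  hasDerivAt_comp_of_mem_ambientGradients (c := fun t => WithLp.toLp 2 (c t, y)) hg hS
    (hc.toLp_prodMk (hasDerivAt_const a y))

theorem isCompact_modeProduct_singleton : IsCompact (modeProduct {p₀} N) := by
  refine Set.Finite.isCompact (((finite_Icc 1 N).image
    fun q : ℕ => (WithLp.toLp 2 (p₀, (q : ℝ)) : PlantState n)).subset ?_)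
  rintro ⟨p, s⟩ ⟨hp, q, hq, hs⟩
  refine ⟨q, hq, ?_⟩
  have hp : p = p₀ := hp
  have hs : s = q := hs
  rw [hp, hs]

theorem modeProduct_mono {M' : Set (EuclideanSpace ℝ (Fin n))} (h : M ⊆ M') :
    modeProduct M N ⊆ modeProduct M' N := fun _ hx => ⟨h hx.1, hx.2⟩

theorem Metric.infDist_eq_of_le {α : Type*} [PseudoMetricSpace α] {A : Set α} {z a : α} {ρ : ℝ}
    (ha : a ∈ A) (hz : dist z a = ρ) (h : ∀ y ∈ A, ρ ≤ dist z y) : Metric.infDist z A = ρ :=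
  le_antisymm (hz ▸ Metric.infDist_le_dist_of_mem ha) ((Metric.le_infDist ⟨a, ha⟩).2 fun y hy => h y hy)

theorem infDist_modeProduct_singleton {x : PlantState n} (hx : x ∈ modeProduct M N) :
    Metric.infDist x (modeProduct {p₀} N) = dist x.fst p₀ := by
  obtain ⟨-, q, hq, hs⟩ := hx
  refine Metric.infDist_eq_of_le (a := WithLp.toLp 2 (p₀, (q : ℝ))) ⟨rfl, q, hq, rfl⟩
    (dist_plantState_eq hs) ?_
  rintro y ⟨hy, -⟩
  have hy : y.fst = p₀ := hy
  exact hy ▸ WithLp.dist_fst_le x y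

theorem infDist_prod_modeProduct_singleton {P : Type*} [NormedAddCommGroup P]
    {ξ : WithLp 2 (PlantState n × P)} {Θ : Set P} (hx : ξ.fst ∈ modeProduct M N)
    (hθ : ξ.snd ∈ Θ) :
    Metric.infDist ξ {ξ : WithLp 2 (PlantState n × P) | ξ.fst ∈ modeProduct {p₀} N ∧ ξ.snd ∈ Θ} =
      dist ξ.fst.fst p₀ := by
  obtain ⟨-, q, hq, hs⟩ := hx
  refine Metric.infDist_eq_of_le
    (a := WithLp.toLp 2 (WithLp.toLp 2 (p₀, (q : ℝ)), ξ.snd)) ⟨⟨rfl, q, hq, rfl⟩, hθ⟩ ?_ ?_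
  · rw [WithLp.prod_dist_eq_of_L2]
    have : dist ξ.fst (WithLp.toLp 2 (p₀, (q : ℝ))) = dist ξ.fst.fst p₀ := dist_plantState_eq hs
    simp [this]
  · rintro y ⟨⟨hy, -⟩, -⟩
    have hy : y.fst.fst = p₀ := hy
    rw [← hy]
    exact (WithLp.dist_fst_le ξ.fst y.fst).trans (WithLp.dist_fst_le ξ y)

namespace IsSynergisticFamily

theorem isC1LipOn_synergisticPotential (hV : IsSynergisticFamily M p₀ N V δ) :
    IsC1LipOn (synergisticPotential V) (modeProduct M N) := by
  rintro x ⟨hx, q, hq, hs⟩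
  obtain ⟨U, W, hU, hxU, hW, hWV⟩ := hV.isC1 q hq x.fst hx
  have hL := hW.comp_clm hU (WithLp.fstL 2 ℝ (EuclideanSpace ℝ (Fin n)) ℝ)
  -- modes are at distance at least `1` from each other
  set B : Set (PlantState n) := {y | dist y.snd (q : ℝ) < 1} with hB
  have hBo : IsOpen B := isOpen_lt (by fun_prop) continuous_const
  refine ⟨_ ∩ B, _, (hU.preimage (WithLp.fstL 2 ℝ _ ℝ).continuous).inter hBo, ⟨hxU, ?_⟩,
    ⟨hL.1.mono inter_subset_left, hL.2.mono inter_subset_left⟩, ?_⟩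
  · simp [hB, hs]
  · rintro y ⟨⟨hyU, hyB⟩, hyM, q', hq', hs'⟩
    have hqq : q' = q := by
      have h1 : dist (q' : ℝ) q < 1 := hs' ▸ hyB
      rw [Nat.dist_cast_real] at h1
      by_contra hne
      exact absurd (Nat.pairwise_one_le_dist hne) (not_le.2 h1)
    rw [synergisticPotential_eq hs', hqq]
    exact hWV ⟨hyU, hyM⟩

/-- Along tangent vectors of `M`, the gradient of `V(p, q)` acts as that of `V_q`. -/
theorem inner_eq_of_mem_ambientGradients {x : PlantState n} {q : ℕ}
    (hq : q ∈ Icc 1 N) (hs : x.snd = (q : ℝ)) {g : PlantState n} {g' v : EuclideanSpace ℝ (Fin n)}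
    (hg : g ∈ ambientGradients (synergisticPotential V) (modeProduct M N) x)
    (hg' : g' ∈ ambientGradients (V q) M x.fst) (hv : v ∈ tangentVectors M x.fst) :
    (inner ℝ g (WithLp.toLp 2 (v, (0 : ℝ))) : ℝ) = inner ℝ g' v := by
  obtain ⟨c, hcM, hc0, hc⟩ := hv
  have hx' : x = WithLp.toLp 2 (c 0, (q : ℝ)) := by
    rw [hc0, ← hs]
    rfl
  rw [hx'] at hg
  rw [← hc0] at hg'
  have h1 := hasDerivAt_comp_toLp_of_mem_ambientGradients hg
    (by filter_upwards [hcM] with t ht using ⟨ht, q, hq, rfl⟩) hc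
  have h2 := hasDerivAt_comp_of_mem_ambientGradients hg' hcM hc
  refine h1.unique (h2.congr_of_eventuallyEq (Eventually.of_forall fun t => ?_))
  exact synergisticPotential_eq rfl

theorem synergisticPotential_nonneg (hV : IsSynergisticFamily M p₀ N V δ) {x : PlantState n}
    (hx : x ∈ modeProduct M N) : 0 ≤ synergisticPotential V x := by
  obtain ⟨hx, q, hq, hs⟩ := hx
  rw [synergisticPotential_eq hs]
  exact hV.nonneg hq hx

/-- `𝒦∞` bounds of the potential in terms of the distance to `p₀`, from the uniform estimates of
the finitely many `V_q`. -/
theorem exists_isClassKInfty_bounds (hV : IsSynergisticFamily M p₀ N V δ) (hMc : IsClosed M) :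
    ∃ α₁ α₂ : ℝ → ℝ, IsClassKInfty α₁ ∧ IsClassKInfty α₂ ∧ ∀ x ∈ modeProduct M N,
      α₁ (dist x.fst p₀) ≤ synergisticPotential V x ∧
        synergisticPotential V x ≤ α₂ (dist x.fst p₀) := by
  have : Nonempty (modeProduct M N) :=
    ⟨⟨WithLp.toLp 2 (p₀, (1 : ℕ)), hV.mem, 1, ⟨le_rfl, hV.one_le⟩, rfl⟩⟩
  have hfin := finite_Icc 1 N
  have hpos : ∀ x : modeProduct M N, 0 ≤ synergisticPotential V x :=
    fun x => hV.synergisticPotential_nonneg x.2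
  have hsmall : ∀ P : ℕ → ℝ → Prop, (∀ q η η', η' ≤ η → P q η → P q η') →
      (∀ q ∈ Icc 1 N, ∃ η > 0, P q η) → ∃ η > 0, ∀ q ∈ Icc 1 N, P q η := by
    intro P hP h
    choose! η hη hPη using h
    obtain ⟨e, he, hle⟩ := hfin.exists_pos_forall_le hη
    exact ⟨e, he, fun q hq => hP q _ _ (hle q hq) (hPη q hq)⟩
  have hlarge : ∀ P : ℕ → ℝ → Prop, (∀ q R R', R ≤ R' → P q R → P q R') →
      (∀ q ∈ Icc 1 N, ∃ R, P q R) → ∃ R, ∀ q ∈ Icc 1 N, P q R := by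
    intro P hP h
    choose! R hPR using h
    obtain ⟨B, hB⟩ := (hfin.image R).bddAbove
    exact ⟨B, fun q hq => hP q _ _ (hB (mem_image_of_mem R hq)) (hPR q hq)⟩
  obtain ⟨α₁, hα₁, h₁⟩ := exists_isClassKInfty_le hpos
      (g := fun x : modeProduct M N => dist x.1.fst p₀) (fun ε hε => by
    obtain ⟨η, hη, h⟩ := hsmall (fun q η => ∀ p ∈ M, ε ≤ dist p p₀ → η ≤ V q p)
      (fun q η η' h h' p hp hd => h.trans (h' p hp hd))
      fun q hq => hV.exists_pos_le_of_le_dist hq hε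
    refine ⟨η, hη, ?_⟩
    rintro ⟨x, hx, q, hq, hs⟩ hd
    rw [synergisticPotential_eq hs]
    exact h q hq _ hx hd) (fun c => by
    obtain ⟨R, h⟩ := hlarge (fun q R => ∀ p ∈ M, R ≤ dist p p₀ → c ≤ V q p)
      (fun q R R' h h' p hp hd => h' p hp (h.trans hd))
      fun q hq => hV.exists_forall_le_of_le_dist hq c
    refine ⟨R, ?_⟩
    rintro ⟨x, hx, q, hq, hs⟩ hd
    rw [synergisticPotential_eq hs]
    exact h q hq _ hx hd) fun _ => dist_nonneg
  obtain ⟨α, hα, h₂⟩ := exists_isClassKInfty_le (f := fun x : modeProduct M N => dist x.1.fst p₀)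
      (g := fun x => synergisticPotential V x) (fun _ => dist_nonneg) (fun ε hε => by
    obtain ⟨η, hη, h⟩ := hsmall (fun q η => ∀ p ∈ M, ε ≤ V q p → η ≤ dist p p₀)
      (fun q η η' h h' p hp hd => h.trans (h' p hp hd))
      fun q hq => hV.exists_pos_le_dist_of_le hq hε
    refine ⟨η, hη, ?_⟩
    rintro ⟨x, hx, q, hq, hs⟩ hd
    exact h q hq _ hx (synergisticPotential_eq (V := V) hs ▸ hd)) (fun c => by
    obtain ⟨R, h⟩ := hlarge (fun q R => ∀ p ∈ M, R ≤ V q p → c ≤ dist p p₀)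
      (fun q R R' h h' p hp hd => h' p hp (h.trans hd))
      fun q hq => hV.exists_forall_le_dist_of_le hMc hq c
    refine ⟨R, ?_⟩
    rintro ⟨x, hx, q, hq, hs⟩ hd
    exact h q hq _ hx (synergisticPotential_eq (V := V) hs ▸ hd)) hpos
  obtain ⟨α₂, hα₂, h⟩ := hα.exists_inverse
  exact ⟨α₁, α₂, hα₁, hα₂, fun x hx => ⟨h₁ ⟨x, hx⟩,
    h _ _ (hV.synergisticPotential_nonneg hx) (h₂ ⟨x, hx⟩)⟩⟩

end IsSynergisticFamily

end ModeProduct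

/-! ### The averaged system -/

namespace ControlAffineHybridSystem

variable {X P : Type*} {r : ℕ} [NormedAddCommGroup X] [InnerProductSpace ℝ X]

theorem inner_averagedField (H : ControlAffineHybridSystem X P r) (γ : ℝ) (g x : X) (θ : P) :
    (inner ℝ g (H.averagedField γ g x θ) : ℝ) =
      inner ℝ g (H.f₀ x θ) - γ * ∑ i, (inner ℝ g (H.f i x θ) : ℝ) ^ 2 := by
  rw [averagedField, inner_sub_right, real_inner_smul_right, inner_sum]
  congr 2
  refine Finset.sum_congr rfl fun i _ => ?_
  rw [real_inner_smul_right, sq]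

variable [CompleteSpace X] [NormedAddCommGroup P] [NormedSpace ℝ P]

/-- Along the flow of the averaged system, a function `κ V(x) + A θ` with `A` linear falls
at least at rate `k`, if its formal derivative is at most `-k`. -/
theorem flow_decrease_averaged {H : ControlAffineHybridSystem X P r} {V : X → ℝ} {γ : ℝ}
    {x : HybridArc (WithLp 2 (X × P))} (hx : (H.averaged V γ).IsSolution x)
    (hV : IsC1LipOn V H.stateSet) (κ : ℝ) (A : P →L[ℝ] ℝ) {k : ℝ} {j : ℕ} {a b : ℝ} (hab : a < b)
    (hdom : ∀ s ∈ Icc a b, (s, j) ∈ x.dom)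
    (hder : ∀ s ∈ Icc a b, x.val s j ∈ H.C → ∀ g ∈ ambientGradients V H.stateSet (x.val s j).fst,
      ∀ w ∈ H.exo.flowMap (x.val s j).snd,
      κ * inner ℝ g (H.averagedField γ g (x.val s j).fst (x.val s j).snd) + A w ≤ -k) :
    κ * V (x.val b j).fst + A (x.val b j).snd + k * (b - a) ≤
      κ * V (x.val a j).fst + A (x.val a j).snd := by
  have hint : (interior {t | (t, j) ∈ x.dom}).Nonempty := by
    refine ⟨(a + b) / 2, interior_mono (s := Icc a b) hdom ?_⟩
    rw [interior_Icc]
    constructor <;> linarith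
  have hC : ∀ s ∈ Icc a b, x.val s j ∈ H.C := fun s hs => hx.flow_mem j hint s (hdom s hs)
  refine hx.flow_decrease (ℓ := fun ξ => κ * V ξ.fst + A ξ.snd) ?_ hab hdom ?_
  · intro ξ hξ
    obtain ⟨K, t, ht, hK⟩ := hV.locallyLipschitzOn (show ξ.fst ∈ H.stateSet from Or.inl hξ.1)
    refine ⟨‖κ‖₊ * K + ‖A‖₊, WithLp.fst ⁻¹' t, ?_, LipschitzOnWith.of_dist_le_mul ?_⟩
    · refine (WithLp.continuous_fst 2 X P).continuousWithinAt.preimage_mem_nhdsWithin' ?_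
      refine nhdsWithin_mono _ ?_ ht
      rintro _ ⟨y, hy, rfl⟩
      exact Or.inl hy.1
    · intro y hy z hz
      have h1 : |V y.fst - V z.fst| ≤ K * dist y z := (hK.dist_le_mul _ hy _ hz).trans
        (mul_le_mul_of_nonneg_left (WithLp.dist_fst_le y z) K.2)
      have h2 : |A y.snd - A z.snd| ≤ ‖A‖ * dist y z := (A.lipschitz.dist_le_mul _ _).trans
        (mul_le_mul_of_nonneg_left (WithLp.dist_snd_le y z) (norm_nonneg A))
      calc |κ * V y.fst + A y.snd - (κ * V z.fst + A z.snd)|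
          = |κ * (V y.fst - V z.fst) + (A y.snd - A z.snd)| := by ring_nf
        _ ≤ |κ| * |V y.fst - V z.fst| + |A y.snd - A z.snd| :=
            (abs_add_le _ _).trans_eq (by rw [abs_mul])
        _ ≤ |κ| * (K * dist y z) + ‖A‖ * dist y z := by gcongr
        _ = _ := by
            push_cast
            rw [Real.norm_eq_abs]
            ring
  · rintro s hs v ⟨⟨g, hg, hgv⟩, hv⟩ hd
    have hsI : s ∈ Icc a b := Ioo_subset_Icc_self hs
    have h1 : HasDerivAt (fun t => (x.val t j).fst) v.fst s :=
      (WithLp.fstL 2 ℝ X P).hasFDerivAt.comp_hasDerivAt s hd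
    have h2 : HasDerivAt (fun t => (x.val t j).snd) v.snd s :=
      (WithLp.sndL 2 ℝ X P).hasFDerivAt.comp_hasDerivAt s hd
    have h3 := hasDerivAt_comp_of_mem_ambientGradients (c := fun t => (x.val t j).fst) hg (by
      filter_upwards [Ioo_mem_nhds hs.1 hs.2] with t ht
      exact Or.inl (hC t (Ioo_subset_Icc_self ht)).1) h1
    refine ⟨_, ?_, (h3.const_mul κ).add (A.hasFDerivAt.comp_hasDerivAt s h2)⟩
    rw [hgv]
    exact hder s hsI (hC s hsI) g hg _ hv

end ControlAffineHybridSystem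

/-! ### The switched plant -/

section Plant

variable {n d r N : ℕ} {M : Set (EuclideanSpace ℝ (Fin n))}
  {b : Fin r → EuclideanSpace ℝ (Fin n) → EuclideanSpace ℝ (Fin n)}
  {𝓔 : Set (EuclideanSpace ℝ (Fin r))} {T₀ χ₁ χ₂ : ℝ} {p₀ : EuclideanSpace ℝ (Fin n)}
  {V : ℕ → EuclideanSpace ℝ (Fin n) → ℝ} {δ γ : ℝ}

theorem stateSet_synergisticPlant :
    (synergisticPlant M b N V δ 𝓔 T₀ χ₁ χ₂).stateSet = modeProduct M N := by
  refine Subset.antisymm (union_subset (fun x hx => hx.1) fun x hx => hx.1) fun x hx => ?_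
  rcases le_total (synergisticPotential V x - minPotential N V x.fst) δ with h | h
  · exact Or.inl ⟨hx, h⟩
  · exact Or.inr ⟨hx, h⟩

theorem inner_averagedField_synergisticPlant (g x : PlantState n) (θ : GainState r) :
    (inner ℝ g ((synergisticPlant M b N V δ 𝓔 T₀ χ₁ χ₂).averagedField γ g x θ) : ℝ) =
      -(γ * ∑ i, (θ.fst i * inner ℝ g (WithLp.toLp 2 (b i x.fst, (0 : ℝ)))) ^ 2) := by
  rw [ControlAffineHybridSystem.inner_averagedField]
  simp only [synergisticPlant, inner_zero_right, zero_sub, real_inner_smul_right]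

theorem inner_averagedField_synergisticPlant_nonpos (hγ : 0 < γ) (g x : PlantState n)
    (θ : GainState r) :
    (inner ℝ g ((synergisticPlant M b N V δ 𝓔 T₀ χ₁ χ₂).averagedField γ g x θ) : ℝ) ≤ 0 := by
  rw [inner_averagedField_synergisticPlant, neg_nonpos]
  exact mul_nonneg hγ.le (Finset.sum_nonneg fun i _ => sq_nonneg _)

theorem union_gainAutomaton :
    (gainAutomaton 𝓔 T₀ χ₁ χ₂).flowSet ∪ (gainAutomaton 𝓔 T₀ χ₁ χ₂).jumpSet =
      (gainAutomaton 𝓔 T₀ χ₁ χ₂).flowSet :=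
  union_eq_left.2 fun _ hθ => ⟨hθ.1, ⟨hθ.2.1.symm ▸ zero_le_one, hθ.2.1.le⟩, hθ.2.2⟩

theorem isCompact_flowSet_gainAutomaton (h𝓔 : 𝓔.Finite) :
    IsCompact (gainAutomaton 𝓔 T₀ χ₁ χ₂).flowSet :=
  h𝓔.isCompact.withLp_prod (isCompact_Icc.withLp_prod isCompact_Icc)

/-- A jump of the interconnection moves the mode to a minimizer, which lowers the potential by at
least `δ`, or else leaves the plant state and resets the timer from `1` to `0`. -/
theorem jump_cases {ξ ξ' : WithLp 2 (PlantState n × GainState r)}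
    (h : ξ' ∈ (synergisticPlant M b N V δ 𝓔 T₀ χ₁ χ₂).G ξ) :
    (ξ'.fst ∈ modeProduct M N ∧ ξ'.snd ∈ (gainAutomaton 𝓔 T₀ χ₁ χ₂).flowSet ∧
      ξ'.snd.snd.snd = ξ.snd.snd.snd) ∧
    ((synergisticPotential V ξ'.fst + δ ≤ synergisticPotential V ξ.fst ∧
        ξ'.snd.snd.fst ≤ ξ.snd.snd.fst) ∨
      (synergisticPotential V ξ'.fst = synergisticPotential V ξ.fst ∧
        ξ'.snd.snd.fst + 1 = ξ.snd.snd.fst)) := by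
  have hX : ∀ x ∈ (synergisticPlant M b N V δ 𝓔 T₀ χ₁ χ₂).jumpSet,
      ∀ x' ∈ (synergisticPlant M b N V δ 𝓔 T₀ χ₁ χ₂).jumpMap x,
      x' ∈ modeProduct M N ∧ synergisticPotential V x' + δ ≤ synergisticPotential V x := by
    rintro x ⟨hx, hδ⟩ x' ⟨hp, q, hq, hs, hmin⟩
    refine ⟨⟨by rw [hp]; exact hx.1, q, hq, hs⟩, ?_⟩
    rw [synergisticPotential_eq hs, hp, eq_minPotential_of_isMinOn hq hmin]
    linarith
  have hΘ : ∀ θ ∈ (gainAutomaton 𝓔 T₀ χ₁ χ₂).jumpSet,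
      ∀ θ' ∈ (gainAutomaton 𝓔 T₀ χ₁ χ₂).jumpMap θ,
      θ' ∈ (gainAutomaton 𝓔 T₀ χ₁ χ₂).flowSet ∧ θ'.snd.snd = θ.snd.snd ∧
        θ'.snd.fst + 1 = θ.snd.fst := by
    rintro θ ⟨-, h1, h2⟩ θ' ⟨h3, h4, h5⟩
    refine ⟨⟨h3.1, ?_, h5 ▸ h2⟩, h5, by rw [h4, h1, zero_add]⟩
    rw [h4]
    exact ⟨le_rfl, zero_le_one⟩
  rcases h with ⟨hx, hθ, hx', hθ'⟩ | ⟨hx, hθ, hx', hθ'⟩ | ⟨hx, hθ, hx', hθ'⟩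
  · obtain ⟨h1, h2⟩ := hX _ hx _ hx'
    obtain ⟨h3, h4, h5⟩ := hΘ _ hθ _ hθ'
    exact ⟨⟨h1, h3, h4⟩, Or.inl ⟨h2, by linarith⟩⟩
  · obtain ⟨h3, h4, h5⟩ := hΘ _ hθ _ hθ'
    exact ⟨⟨hx' ▸ hx.1, h3, h4⟩, Or.inr ⟨by rw [hx'], h5⟩⟩
  · obtain ⟨h1, h2⟩ := hX _ hx _ hx'
    exact ⟨⟨h1, hθ' ▸ hθ, by rw [hθ']⟩, Or.inl ⟨h2, by rw [hθ']⟩⟩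

/-- Between two positive levels, the potential decays at a uniform positive rate wherever no gain
vanishes. -/
theorem exists_uniform_decay (hM : IsSmoothSubmanifold d M) (hb : ∀ i, IsC1LipOn (b i) M)
    (hbT : ∀ i, ∀ p ∈ M, b i p ∈ tangentVectors M p)
    (hspan : ∃ lam : ℝ, 0 < lam ∧ ∀ p ∈ M, ∀ v ∈ tangentVectors M p,
      lam * inner ℝ v v ≤ ∑ i, (inner ℝ (b i p) v) ^ 2)
    (h𝓔 : 𝓔.Finite) (hV : IsSynergisticFamily M p₀ N V δ) (hγ : 0 < γ) {a : ℝ} (ha : 0 < a)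
    (c : ℝ) :
    ∃ w > 0, ∀ ξ ∈ (synergisticPlant M b N V δ 𝓔 T₀ χ₁ χ₂).C,
      a ≤ synergisticPotential V ξ.fst → synergisticPotential V ξ.fst ≤ c →
      ξ.snd ∉ blindSet r →
      ∀ g ∈ ambientGradients (synergisticPotential V) (modeProduct M N) ξ.fst,
        (inner ℝ g ((synergisticPlant M b N V δ 𝓔 T₀ χ₁ χ₂).averagedField γ g ξ.fst ξ.snd) : ℝ) ≤
          -w := by
  obtain ⟨lam, hlam, hspan⟩ := hspan
  have hmode := fun q (hq : q ∈ Icc 1 N) =>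
    hV.exists_pos_le_sum_inner_sq hM hb hbT hlam hspan hq ha c
  choose! w hw hdecay using hmode
  obtain ⟨w₀, hw₀, hw₀w⟩ := (finite_Icc 1 N).exists_pos_forall_le hw
  obtain ⟨e, he, hele⟩ := ((h𝓔.prod (finite_univ (α := Fin r))).subset
    (sep_subset _ fun z => z.1 z.2 ≠ 0)).exists_pos_forall_le (f := fun z => (z.1 z.2) ^ 2)
    fun z hz => by have := hz.2; positivity
  refine ⟨γ * (e * w₀), by positivity, ?_⟩
  rintro ξ ⟨⟨⟨hpM, q, hq, hs⟩, hμ⟩, hθ⟩ h1 h2 hblind g hg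
  have hμ : synergisticPotential V ξ.fst - minPotential N V ξ.fst.fst ≤ δ := hμ
  rw [synergisticPotential_eq hs] at h1 h2 hμ
  obtain ⟨g', hg'⟩ := (hV.isC1 q hq).nonempty_ambientGradients hpM
  have h3 := (hw₀w q hq).trans (hdecay q hq _ hpM h1 h2 hμ g' hg')
  rw [inner_averagedField_synergisticPlant]
  refine neg_le_neg (mul_le_mul_of_nonneg_left ?_ hγ.le)
  refine (mul_le_mul_of_nonneg_left h3 he.le).trans ?_
  rw [Finset.mul_sum]
  refine Finset.sum_le_sum fun i _ => ?_
  rw [IsSynergisticFamily.inner_eq_of_mem_ambientGradients hq hs hg hg' (hbT i _ hpM), mul_pow]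
  refine mul_le_mul_of_nonneg_right ?_ (sq_nonneg _)
  exact hele (ξ.snd.fst, i) ⟨⟨hθ.1, mem_univ _⟩, fun h0 => hblind ⟨i, h0⟩⟩

/-- Solutions stay in the product of the state set with the flow set of the gain automaton. -/
theorem val_mem_of_isSolution {x : HybridArc (WithLp 2 (PlantState n × GainState r))}
    (hx : ((synergisticPlant M b N V δ 𝓔 T₀ χ₁ χ₂).averaged
      (synergisticPotential V) γ).IsSolution x) {T : ℝ} {J : ℕ} (h : (T, J) ∈ x.dom) :
    (x.val T J).fst ∈ modeProduct M N ∧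
      (x.val T J).snd ∈ (gainAutomaton 𝓔 T₀ χ₁ χ₂).flowSet := by
  have hΘ : (gainAutomaton 𝓔 T₀ χ₁ χ₂).jumpSet ⊆ (gainAutomaton 𝓔 T₀ χ₁ χ₂).flowSet :=
    union_eq_left.1 union_gainAutomaton
  refine hx.mem_of_invariant (Ω := {ξ | ξ.fst ∈ modeProduct M N ∧
    ξ.snd ∈ (gainAutomaton 𝓔 T₀ χ₁ χ₂).flowSet}) (fun ξ hξ => ⟨hξ.1.1, hξ.2⟩) ?_ ?_ h
  · rintro ξ (h | h | h)
    · exact ⟨h.1.1, hΘ h.2⟩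
    · exact ⟨h.1.1, h.2⟩
    · exact ⟨h.1.1, hΘ h.2⟩
  · intro ξ _ ξ' hξ'
    exact ⟨(jump_cases hξ').1.1, (jump_cases hξ').1.2.1⟩

/-- The potential does not increase along solutions. -/
theorem synergisticPotential_le_of_isSolution (hV : IsSynergisticFamily M p₀ N V δ) (hγ : 0 < γ)
    {x : HybridArc (WithLp 2 (PlantState n × GainState r))}
    (hx : ((synergisticPlant M b N V δ 𝓔 T₀ χ₁ χ₂).averaged
      (synergisticPotential V) γ).IsSolution x) {s T : ℝ} {j J : ℕ} (h : (T, J) ∈ x.dom)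
    (hs : (s, j) ∈ x.dom) (hsT : s ≤ T) (hjJ : j ≤ J) :
    synergisticPotential V (x.val T J).fst ≤ synergisticPotential V (x.val s j).fst := by
  have := x.isHybridTimeDomain.decrease h
    (fun s j => synergisticPotential V (x.val s j).fst) 0 ?_ ?_ hs hsT hjJ
  · simpa using this
  · intro j _ t t' htt' _ hdom
    have := ControlAffineHybridSystem.flow_decrease_averaged hx
      (stateSet_synergisticPlant ▸ hV.isC1LipOn_synergisticPotential) 1 0 (k := 0) htt' hdom
      fun u _ _ g _ v _ => by
        simpa using inner_averagedField_synergisticPlant_nonpos hγ g _ _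
    simpa using this
  · intro t j _ _ h1 h2
    rcases (jump_cases (hx.jump t j h1 h2).2).2 with h3 | h3
    · linarith [hV.gap_pos]
    · linarith

/-- While the potential stays above `a > 0`, the function
`K V + κ θ_{r+2} + θ_{r+1}` falls at least at unit rate in the hybrid time `t + j`: the monitor
`θ_{r+2}` compensates for the time spent with a vanishing gain, and the timer `θ_{r+1}` and the gap
`δ` account for the jumps. Since it is nonnegative, this bounds `t + j`. -/
theorem exists_time_bound (hM : IsSmoothSubmanifold d M) (hb : ∀ i, IsC1LipOn (b i) M)
    (hbT : ∀ i, ∀ p ∈ M, b i p ∈ tangentVectors M p)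
    (hspan : ∃ lam : ℝ, 0 < lam ∧ ∀ p ∈ M, ∀ v ∈ tangentVectors M p,
      lam * inner ℝ v v ≤ ∑ i, (inner ℝ (b i p) v) ^ 2)
    (h𝓔 : 𝓔.Finite) (hχ₁ : 0 < χ₁) (hχ₂ : χ₂ ∈ Ioo (0 : ℝ) 1)
    (hV : IsSynergisticFamily M p₀ N V δ) (hγ : 0 < γ) {a : ℝ} (ha : 0 < a) (c : ℝ) :
    ∃ B : ℝ, ∀ x : HybridArc (WithLp 2 (PlantState n × GainState r)),
      ((synergisticPlant M b N V δ 𝓔 T₀ χ₁ χ₂).averaged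
        (synergisticPotential V) γ).IsSolution x →
      synergisticPotential V (x.val 0 0).fst ≤ c → ∀ (T : ℝ) (J : ℕ), (T, J) ∈ x.dom →
      a ≤ synergisticPotential V (x.val T J).fst → T + J ≤ B := by
  obtain ⟨w, hw, hdecay⟩ := exists_uniform_decay (T₀ := T₀) (χ₁ := χ₁) (χ₂ := χ₂) hM hb hbT hspan
    h𝓔 hV hγ ha c
  have hδ := hV.gap_pos
  have hχ : 0 < 1 - χ₂ := sub_pos.2 hχ₂.2
  -- `κ (1 - χ₂)` exceeds the growth rate `χ₁` of the timer by one
  set κ : ℝ := (χ₁ + 1) / (1 - χ₂) with hκ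
  have hκ0 : 0 < κ := by positivity
  have hκχ : κ * (1 - χ₂) = χ₁ + 1 := div_mul_cancel₀ _ hχ.ne'
  -- `K` is the weight `κ / w` of the potential, increased so that `K δ ≥ 1`
  set K : ℝ := max (κ / w) (1 / δ) with hK
  have hKw : κ ≤ K * w := (div_le_iff₀ hw).1 (le_max_left _ _)
  have hKδ : 1 ≤ K * δ := (div_le_iff₀ hδ).1 (le_max_right _ _)
  have hK0 : 0 < K := lt_max_of_lt_right (by positivity)
  set A : GainState r →L[ℝ] ℝ := κ • (WithLp.sndL 2 ℝ ℝ ℝ).comp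
      (WithLp.sndL 2 ℝ (EuclideanSpace ℝ (Fin r)) (WithLp 2 (ℝ × ℝ))) +
    (WithLp.fstL 2 ℝ ℝ ℝ).comp
      (WithLp.sndL 2 ℝ (EuclideanSpace ℝ (Fin r)) (WithLp 2 (ℝ × ℝ))) with hA
  have hAθ : ∀ θ : GainState r, A θ = κ * θ.snd.snd + θ.snd.fst := fun θ => rfl
  refine ⟨K * c + (κ * T₀ + 1), fun x hx hc T J h haT => ?_⟩
  have h0 := x.isHybridTimeDomain.zero_mem
  have hT0 : 0 ≤ T := x.isHybridTimeDomain.2.1 _ h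
  have hmain := x.isHybridTimeDomain.decrease h
    (fun s j => K * synergisticPotential V (x.val s j).fst + A (x.val s j).snd) 1 ?_ ?_ h0 hT0
    (Nat.zero_le J)
  · obtain ⟨h1, h2⟩ := val_mem_of_isSolution hx h
    obtain ⟨-, h3⟩ := val_mem_of_isSolution hx h0
    have h4 := hV.synergisticPotential_nonneg h1
    have h5 : 0 ≤ A (x.val T J).snd := by
      rw [hAθ]
      exact add_nonneg (mul_nonneg hκ0.le h2.2.2.1) h2.2.1.1
    have h6 : A (x.val 0 0).snd ≤ κ * T₀ + 1 := by
      rw [hAθ]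
      exact add_le_add (mul_le_mul_of_nonneg_left h3.2.2.2 hκ0.le) h3.2.1.2
    have h7 := mul_le_mul_of_nonneg_left hc hK0.le
    have h8 := mul_nonneg hK0.le h4
    simp only [Nat.cast_zero, add_zero, mul_zero, one_mul] at hmain
    linarith
  · intro j hj t t' htt' ht'T hdom
    refine ControlAffineHybridSystem.flow_decrease_averaged hx
      (stateSet_synergisticPlant ▸ hV.isC1LipOn_synergisticPotential) K A htt' hdom ?_
    rintro u hu hC g hg v ⟨-, hv1, σ, hσ, hv2⟩
    rw [stateSet_synergisticPlant] at hg
    have hud := hdom u hu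
    have h1 := haT.trans (synergisticPotential_le_of_isSolution hV hγ hx h hud
      (hu.2.trans ht'T) hj)
    have h2 := (synergisticPotential_le_of_isSolution hV hγ hx hud h0
      (x.isHybridTimeDomain.2.1 _ hud) (Nat.zero_le j)).trans hc
    rw [hAθ, hv2]
    have h3 : κ * σ ≤ κ * χ₂ := mul_le_mul_of_nonneg_left hσ.2 hκ0.le
    have h4 := hv1.2
    by_cases hblind : (x.val u j).snd ∈ blindSet r
    · have h5 := mul_nonpos_of_nonneg_of_nonpos hK0.le
        (inner_averagedField_synergisticPlant_nonpos (M := M) (b := b) (N := N) (V := V) (δ := δ)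
          (𝓔 := 𝓔) (T₀ := T₀) (χ₁ := χ₁) (χ₂ := χ₂) hγ g (x.val u j).fst (x.val u j).snd)
      rw [indicator_of_mem hblind, Pi.one_apply]
      linarith
    · have h5 := mul_le_mul_of_nonneg_left (hdecay _ hC h1 h2 hblind g hg) hK0.le
      rw [indicator_of_notMem hblind]
      linarith
  · intro t j _ _ h1 h2
    obtain ⟨⟨-, -, hm⟩, hcase⟩ := jump_cases (hx.jump t j h1 h2).2
    simp only [hAθ, hm]
    rcases hcase with ⟨h3, h4⟩ | ⟨h3, h4⟩
    · have := mul_le_mul_of_nonneg_left h3 hK0.le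
      linarith
    · rw [h3]
      linarith

/-- The potential gives stability, through its `𝒦∞` bounds, and `exists_time_bound` gives uniform
attractivity: by the time it allows, the potential is below `α₁ ε`, hence the distance below `ε`. -/
theorem isUGAS_averaged (hM : IsSmoothSubmanifold d M) (hMc : IsClosed M)
    (hb : ∀ i, IsC1LipOn (b i) M) (hbT : ∀ i, ∀ p ∈ M, b i p ∈ tangentVectors M p)
    (hspan : ∃ lam : ℝ, 0 < lam ∧ ∀ p ∈ M, ∀ v ∈ tangentVectors M p,
      lam * inner ℝ v v ≤ ∑ i, (inner ℝ (b i p) v) ^ 2)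
    (h𝓔 : 𝓔.Finite) (hχ₁ : 0 < χ₁) (hχ₂ : χ₂ ∈ Ioo (0 : ℝ) 1)
    (hV : IsSynergisticFamily M p₀ N V δ) (hγ : 0 < γ) :
    ((synergisticPlant M b N V δ 𝓔 T₀ χ₁ χ₂).averaged (synergisticPotential V) γ).IsUGAS
      {ξ : WithLp 2 (PlantState n × GainState r) | ξ.fst ∈ modeProduct {p₀} N ∧
        ξ.snd ∈ (gainAutomaton 𝓔 T₀ χ₁ χ₂).flowSet ∪ (gainAutomaton 𝓔 T₀ χ₁ χ₂).jumpSet} := by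
  rw [union_gainAutomaton]
  refine ⟨isCompact_modeProduct_singleton.withLp_prod (isCompact_flowSet_gainAutomaton h𝓔), ?_⟩
  obtain ⟨α₁, α₂, hα₁, hα₂, hα⟩ := hV.exists_isClassKInfty_bounds hMc
  set H := (synergisticPlant M b N V δ 𝓔 T₀ χ₁ χ₂).averaged (synergisticPotential V) γ with hH
  -- the points of the domains of all solutions, with initial distance, time, and distance
  let ι := {z : HybridArc (WithLp 2 (PlantState n × GainState r)) × ℝ × ℕ //
    H.IsSolution z.1 ∧ z.2 ∈ z.1.dom}
  have hbound : ∀ z : ι, α₁ (dist (z.1.1.val z.1.2.1 z.1.2.2).fst.fst p₀) ≤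
      α₂ (dist (z.1.1.val 0 0).fst.fst p₀) := by
    rintro ⟨⟨x, t, j⟩, hx, h⟩
    have h0 := x.isHybridTimeDomain.zero_mem
    exact (hα _ (val_mem_of_isSolution hx h).1).1.trans
      ((synergisticPotential_le_of_isSolution hV hγ hx h h0 (x.isHybridTimeDomain.2.1 _ h)
        (Nat.zero_le j)).trans (hα _ (val_mem_of_isSolution hx h0).1).2)
  have hα₂_le : ∀ ρ ρ', 0 ≤ ρ → ρ ≤ ρ' → α₂ ρ ≤ α₂ ρ' := fun ρ ρ' h h' =>
    hα₂.strictMonoOn.monotoneOn h (h.trans h') h'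
  obtain ⟨σ, hσ, hσle⟩ := hα₁.exists_inverse
  have hσα : ∀ z : ι, ∀ ρ, dist (z.1.1.val 0 0).fst.fst p₀ ≤ ρ →
      dist (z.1.1.val z.1.2.1 z.1.2.2).fst.fst p₀ ≤ σ (α₂ ρ) := fun z ρ hρ =>
    hσle _ _ dist_nonneg ((hbound z).trans (hα₂_le _ _ dist_nonneg hρ))
  have hα₁_pos : ∀ ε > 0, 0 < α₁ ε := fun ε hε => by
    have := hα₁.strictMonoOn (mem_Ici.2 le_rfl) (mem_Ici.2 hε.le) hε
    rwa [hα₁.zero] at this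
  have hstab : ∀ ε > 0, ∃ η > 0, ∀ z : ι, dist (z.1.1.val 0 0).fst.fst p₀ ≤ η →
      dist (z.1.1.val z.1.2.1 z.1.2.2).fst.fst p₀ ≤ ε := by
    intro ε hε
    have hα₁ε := hα₁_pos ε hε
    have hcont : ContinuousWithinAt α₂ (Ici 0) 0 := hα₂.continuousOn 0 (mem_Ici.2 le_rfl)
    obtain ⟨η, hη, hη'⟩ := Metric.continuousWithinAt_iff.1 hcont (α₁ ε) hα₁ε
    refine ⟨η / 2, half_pos hη, fun z hz => ?_⟩
    by_contra! hlt
    have h1 : α₁ ε < α₁ (dist (z.1.1.val z.1.2.1 z.1.2.2).fst.fst p₀) :=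
      hα₁.strictMonoOn (mem_Ici.2 hε.le) (mem_Ici.2 dist_nonneg) hlt
    have h2 := hη' (x := η / 2) (mem_Ici.2 (half_pos hη).le) (by
      rw [Real.dist_0_eq_abs, abs_of_pos (half_pos hη)]
      exact half_lt_self hη)
    rw [hα₂.zero, Real.dist_0_eq_abs] at h2
    linarith [hbound z, hα₂_le _ _ dist_nonneg hz, le_abs_self (α₂ (η / 2))]
  have hattr : ∀ ρ, ∀ ε > 0, ∃ T, ∀ z : ι, dist (z.1.1.val 0 0).fst.fst p₀ ≤ ρ →
      T ≤ z.1.2.1 + z.1.2.2 → dist (z.1.1.val z.1.2.1 z.1.2.2).fst.fst p₀ ≤ ε := by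
    intro ρ ε hε
    have hα₁ε := hα₁_pos ε hε
    obtain ⟨B, hB⟩ := exists_time_bound (T₀ := T₀) hM hb hbT hspan h𝓔 hχ₁ hχ₂ hV hγ hα₁ε (α₂ ρ)
    refine ⟨B + 1, ?_⟩
    rintro ⟨⟨x, t, j⟩, hx, h⟩ hρ hBt
    by_contra! hlt
    have h1 := hα₁.strictMonoOn (mem_Ici.2 hε.le) (mem_Ici.2 dist_nonneg) hlt
    have h2 := hB x hx ((hα _ (val_mem_of_isSolution hx x.isHybridTimeDomain.zero_mem).1).2.trans
      (hα₂_le _ _ dist_nonneg hρ)) t j h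
      (h1.le.trans (hα _ (val_mem_of_isSolution hx h).1).1)
    have h3 : B + 1 ≤ t + j := hBt
    linarith
  obtain ⟨β, hβ, hle⟩ := exists_isClassKL
    (fun z : ι => dist (z.1.1.val 0 0).fst.fst p₀) (fun z => z.1.2.1 + z.1.2.2)
    (fun z => dist (z.1.1.val z.1.2.1 z.1.2.2).fst.fst p₀)
    (fun ρ => ⟨σ (α₂ ρ), fun z hz => hσα z ρ hz⟩) hstab hattr
  refine ⟨β, hβ, fun x hx t j h => ?_⟩
  obtain ⟨h1, h2⟩ := val_mem_of_isSolution hx h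
  obtain ⟨h3, h4⟩ := val_mem_of_isSolution hx x.isHybridTimeDomain.zero_mem
  rw [infDist_prod_modeProduct_singleton h1 h2, infDist_prod_modeProduct_singleton h3 h4]
  exact hle ⟨⟨x, t, j⟩, hx, h⟩

theorem isSCLFCandidate_synergisticPlant (hMc : IsClosed M)
    (hV : IsSynergisticFamily M p₀ N V δ) (hγ : 0 < γ) :
    (synergisticPlant M b N V δ 𝓔 T₀ χ₁ χ₂).IsSCLFCandidate (modeProduct {p₀} N)
      (synergisticPotential V) γ where
  gain_pos := hγ
  isCompact := isCompact_modeProduct_singleton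
  subset := by
    rw [stateSet_synergisticPlant]
    exact modeProduct_mono (singleton_subset_iff.2 hV.mem)
  isC1 := by
    rw [stateSet_synergisticPlant]
    exact hV.isC1LipOn_synergisticPotential
  nonneg := by
    rw [stateSet_synergisticPlant]
    exact fun x hx => hV.synergisticPotential_nonneg hx
  bounds := by
    obtain ⟨α₁, α₂, hα₁, hα₂, h⟩ := hV.exists_isClassKInfty_bounds hMc
    refine ⟨α₁, α₂, hα₁, hα₂, fun x hx => ?_⟩
    rw [stateSet_synergisticPlant] at hx
    rw [infDist_modeProduct_singleton hx]
    exact h x hx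
  flow_nonpos := fun ξ _ g _ => inner_averagedField_synergisticPlant_nonpos hγ g _ _
  jump_nonpos := fun ξ _ ξ' hξ' => by
    rcases (jump_cases hξ').2 with h | h
    · linarith [hV.gap_pos]
    · linarith

end Plant

theorem proposition1 {n d r N : ℕ}
    (M : Set (EuclideanSpace ℝ (Fin n))) (hM : IsSmoothSubmanifold d M) (hMc : IsClosed M)
    (b : Fin r → EuclideanSpace ℝ (Fin n) → EuclideanSpace ℝ (Fin n))
    (hb : ∀ i, IsC1LipOn (b i) M)
    (hbT : ∀ i, ∀ p ∈ M, b i p ∈ tangentVectors M p)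
    (hspan : ∃ lam : ℝ, 0 < lam ∧ ∀ p ∈ M, ∀ v ∈ tangentVectors M p,
      lam * inner ℝ v v ≤ ∑ i, (inner ℝ (b i p) v) ^ 2)
    (𝓔 : Set (EuclideanSpace ℝ (Fin r))) (h𝓔 : 𝓔.Finite)
    (T₀ χ₁ χ₂ : ℝ) (hT₀ : 0 < T₀) (hχ₁ : 0 < χ₁) (hχ₂ : χ₂ ∈ Set.Ioo (0 : ℝ) 1)
    (p₀ : EuclideanSpace ℝ (Fin n)) (V : ℕ → EuclideanSpace ℝ (Fin n) → ℝ) (δ : ℝ)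
    (hV : IsSynergisticFamily M p₀ N V δ) :
    (synergisticPlant M b N V δ 𝓔 T₀ χ₁ χ₂).IsStronglyGradStabilizable
        (modeProduct {p₀} N) (synergisticPotential V) ∧
      ∀ γ : ℝ, 0 < γ →
        (synergisticPlant M b N V δ 𝓔 T₀ χ₁ χ₂).IsSCLFWithGain
          (modeProduct {p₀} N) (synergisticPotential V) γ := by
  have h : ∀ γ : ℝ, 0 < γ → (synergisticPlant M b N V δ 𝓔 T₀ χ₁ χ₂).IsSCLFWithGain
      (modeProduct {p₀} N) (synergisticPotential V) γ := fun γ hγ =>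
    ⟨isSCLFCandidate_synergisticPlant hMc hV hγ,
      isUGAS_averaged hM hMc hb hbT hspan h𝓔 hχ₁ hχ₂ hV hγ⟩
  exact ⟨⟨1, h 1 one_pos⟩, h⟩
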